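/- Let $\mathbb{Q}(a)$ be the field of rational functions in one variable $a$ over $\mathbb{Q}$, and let $$q_1=-\frac{3a}{7},\qquad q_2=-\frac{(80+9a)(-4+9a)}{756\,a},\qquad q_3=\frac{320}{189\,a},\qquad q_4=-\frac{(4+9a)(-80+9a)}{756\,a}.$$ Then $\{q_1,q_2,q_3,q_4\}$ is a Diophantine quadruple in $\mathbb{Q}(a)$ (the $q_i$ are non-zero and distinct, and $q_iq_j+1$ is a square in $\mathbb{Q}(a)$ for all $i\neq j$). Let $E$ be the elliptic curve over $\mathbb{Q}(a)$ induced by $\{q_1,q_2,q_3\}$, $$E:\quad y^2=(q_1x+1)(q_2x+1)(q_3x+1).$$ The torsion subgroup of $E(\mathbb{Q}(a))$ is isomorphic to $\mathbb{Z}/2\mathbb{Z}\times\mathbb{Z}/2\mathbb{Z}$, and the rank of $E(\mathbb{Q}(a))$ is equal to $4$. Moreover, the change of variables $X=(378a)^2(q_1q_2q_3\,x+q_1q_2)$, $Y=(378a)^3q_1q_2q_3\,y$ transforms $E$ into $Y^2=X^3+A(a)X^2+B(a)X$ with $$A(a)=-2(-51200+109440a+38880a^2+55404a^3+6561a^4),$$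 $$B(a)=243a^2(20+3a)(-4+9a)(16+9a)(80+9a)(320+81a^2).$$ There are four points of $E(\mathbb{Q}(a))$ whose $X$-coordinates in this model are $$X_1=81a^2(-4+9a)(80+9a),\qquad X_2=27a(20+3a)(-4+9a)(80+9a),$$ $$X_3=\tfrac{1}{441}(-4+9a)(80+9a)(160+171a)^2,\qquad X_4=3(20+3a)(-4+9a)(320+81a^2),$$ and any four such points (whatever the choice of the signs of the $Y$-coordinates) are of infinite order and independent, that is, linearly independent over $\mathbb{Z}$ in $E(\mathbb{Q}(a))$. -/

import Mathlib

noncomputable section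

namespace DiophantineTriple

/-- A rational Diophantine `m`-tuple over a field `K`: non-zero, pairwise distinct elements such
that the product of any two of them increased by `1` is a square in `K`. -/
def IsDiophantineTuple {K : Type*} [Field K] {m : ℕ} (c : Fin m → K) : Prop :=
  (∀ i, c i ≠ 0) ∧ Function.Injective c ∧ ∀ i j, i ≠ j → IsSquare (c i * c j + 1)

/-- The elliptic curve induced by `{c₁, c₂, c₃}`, i.e. `y² = (c₁ x + 1)(c₂ x + 1)(c₃ x + 1)`,
in the Weierstrass form `y² = (x + c₁ c₂)(x + c₁ c₃)(x + c₂ c₃)`, which is obtained by the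
coordinate transformation `x ↦ c₁ c₂ c₃ x`, `y ↦ c₁ c₂ c₃ y`. -/
def inducedCurve {K : Type*} [Field K] (c₁ c₂ c₃ : K) : WeierstrassCurve K where
  a₁ := 0
  a₂ := c₁ * c₂ + c₁ * c₃ + c₂ * c₃
  a₃ := 0
  a₄ := c₁ * c₂ * (c₁ * c₃) + c₁ * c₂ * (c₂ * c₃) + c₁ * c₃ * (c₂ * c₃)
  a₆ := c₁ * c₂ * (c₁ * c₃) * (c₂ * c₃)

/-- The points of the induced curve are the `(c₁ c₂ c₃ x, c₁ c₂ c₃ y)` with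
`y² = (c₁ x + 1)(c₂ x + 1)(c₃ x + 1)`. -/
theorem inducedCurve_equation_iff {K : Type*} [Field K] {c₁ c₂ c₃ : K} (h : c₁ * c₂ * c₃ ≠ 0)
    (x y : K) :
    (inducedCurve c₁ c₂ c₃).toAffine.Equation (c₁ * c₂ * c₃ * x) (c₁ * c₂ * c₃ * y) ↔
      y ^ 2 = (c₁ * x + 1) * (c₂ * x + 1) * (c₃ * x + 1) := by
  rw [WeierstrassCurve.Affine.equation_iff]
  simp only [inducedCurve]
  rw [← mul_right_inj' (pow_ne_zero 2 h) (b := y ^ 2)]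
  constructor <;> intro e <;> linear_combination e

/-- The field `ℚ(a)`. -/
abbrev Qa : Type := RatFunc ℚ

/-- The variable `a` of `ℚ(a)`. -/
abbrev a : Qa := RatFunc.X

/-- The quadruple `(q₁, q₂, q₃, q₄)`. -/
def q : Fin 4 → Qa :=
  ![-(3 * a / 7),
    -((80 + 9 * a) * (-4 + 9 * a) / (756 * a)),
    320 / (189 * a),
    -((4 + 9 * a) * (-80 + 9 * a) / (756 * a))]

/-- The curve over `ℚ(a)` induced by `{q₁, q₂, q₃}`. -/
def curve : WeierstrassCurve Qa := inducedCurve (q 0) (q 1) (q 2)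

/-- The model `Y² = X³ + A(a) X² + B(a) X` of the curve. -/
def model : WeierstrassCurve Qa where
  a₁ := 0
  a₂ := -2 * (-51200 + 109440 * a + 38880 * a ^ 2 + 55404 * a ^ 3 + 6561 * a ^ 4)
  a₃ := 0
  a₄ := 243 * a ^ 2 * (20 + 3 * a) * (-4 + 9 * a) * (16 + 9 * a) * (80 + 9 * a) *
    (320 + 81 * a ^ 2)
  a₆ := 0

theorem scale_ne_zero : (378 * a : Qa) ≠ 0 :=
  mul_ne_zero (by norm_num) RatFunc.X_ne_zero

/-- The change of variables `x = u² X + r`, `y = u³ Y`, with `u = 1 / (378 a)` and `r = -q₁ q₂`,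
which transforms `curve` into `model`. -/
def toModel : WeierstrassCurve.VariableChange Qa where
  u := (Units.mk0 (378 * a) scale_ne_zero)⁻¹
  r := -(q 0 * q 1)
  s := 0
  t := 0

theorem toModel_smul_curve : toModel • curve = model := by
  have ha : (a : Qa) ≠ 0 := RatFunc.X_ne_zero
  ext <;> simp only [WeierstrassCurve.variableChange_a₁, WeierstrassCurve.variableChange_a₂,
    WeierstrassCurve.variableChange_a₃, WeierstrassCurve.variableChange_a₄,
    WeierstrassCurve.variableChange_a₆, toModel, curve, inducedCurve, model, inv_inv,
    Units.val_mk0, q, Matrix.cons_val]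
  · ring
  · field_simp
    ring
  · ring
  · field_simp
    ring
  · field_simp
    ring

/-- `P` is an affine point of `curve` whose `X`-coordinate on `model` is `X`. -/
def HasModelX (P : curve.toAffine.Point) (X : Qa) : Prop :=
  ∃ (y : Qa) (h : curve.toAffine.Nonsingular ((toModel.u : Qa) ^ 2 * X + toModel.r) y),
    P = .some ((toModel.u : Qa) ^ 2 * X + toModel.r) y h

/-- The `X`-coordinates `x₁, x₂, x₃, x₄` on `model` of the four points. -/
def xcoord : Fin 4 → Qa :=
  ![81 * a ^ 2 * (-4 + 9 * a) * (80 + 9 * a),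
    27 * a * (20 + 3 * a) * (-4 + 9 * a) * (80 + 9 * a),
    1 / 441 * (-4 + 9 * a) * (80 + 9 * a) * (160 + 171 * a) ^ 2,
    3 * (20 + 3 * a) * (-4 + 9 * a) * (320 + 81 * a ^ 2)]

end DiophantineTriple

end

/-!
The model `Y² = X³ + A X² + B X` is `E : y² = x (x - α) (x - β)` with `α = 243 a² (16 + 9 a) (20 +
3 a)` and `β = (80 + 9 a) (9 a - 4) (320 + 81 a²)`, so all points of order two are rational and a
complete `2`-descent applies. The classes of `x` and `x - α` modulo squares are additive
(`IsSplit.isSquare_kummer_add`), and a point is twice another one if `x`, `x - α` and `x - β` are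
all squares (`IsSplit.exists_half`).

*The group `E / 2 E`.* Composing with parities of orders of vanishing at six places yields six
homomorphisms `orderChar` to `ℤ/2ℤ`. Their values on `P₁`, `P₂`, `R`, `P₄` and the points `T₁`,
`T₂` of order two, where `P₃ = P₁ + 2 R`, form an invertible matrix. Conversely a point
annihilated by all six is divisible by two (`exists_half_of_orderChar`): the squarefree parts of
the numerators of `x` and `x - α` divide the differences of the roots, the six conditions leave
only a constant and the two factors `80 + 9 a` and `320 + 81 a²`, and specialization at the zeros
of `α - β` and of `α` eliminates these. So the six points form a basis of `E / 2 E`.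

*Torsion.* Doubling a point of `2 E` strictly increases the degree of the denominator of `x`
(`natDegree_denom_lt`). Therefore a non-zero point of `2 E` has infinite order unless one of its
multiples is a point of order two in `2 E`, which the characters exclude. Hence the torsion
subgroup is `E[2]`.

*Finite generation.* Specialize at `a = -2`. The parities of the valuations at `2`, `3`, `5`, `7`,
`19` of the leading coefficients at `a = -2` also separate the classes of `E / 2 E`, and they
vanish on points for which `x` has a pole there. Such a point is thus divisible by two, again by a
point with a pole, and the growth of denominators turns this into an infinite descent: no such
point exists (`not_hasPole`). So specialization has finite fibres on `x`-coordinates, and the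
height of the specialized `x`-coordinate satisfies the approximate parallelogram law and the
Northcott property; the descent theorem of Mathlib gives finite generation (`fg_points`).

*Rank.* By Nakayama's lemma the six points generate a subgroup of finite odd index, and `P₁`,
`P₂`, `R`, `P₄` are independent modulo torsion by the invertibility of the matrix. So the rank is
four, and `P₁`, `P₂`, `P₃ = P₁ + 2 R`, `P₄` are independent. Points with the same `x`-coordinate
agree up to sign, which does not affect independence.
-/

noncomputable section

namespace DiophantineTriple

/-! ### Complete `2`-descent on a cubic with rational roots -/

section

open Polynomial

variable {F : Type*} [Field F]

/-- The Weierstrass curve `y² = x (x - α) (x - β)`. -/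
def legendre (α β : F) : WeierstrassCurve F where
  a₁ := 0
  a₂ := -(α + β)
  a₃ := 0
  a₄ := α * β
  a₆ := 0

/-- `W` is the curve `y² = (x - e) (x - f) (x - g)`. -/
structure IsSplit (W : WeierstrassCurve F) (e f g : F) : Prop where
  a₁ : W.a₁ = 0
  a₂ : W.a₂ = -(e + f + g)
  a₃ : W.a₃ = 0
  a₄ : W.a₄ = e * f + e * g + f * g
  a₆ : W.a₆ = -(e * f * g)

theorem isSplit_zero (α β : F) : IsSplit (legendre α β) 0 α β := by
  constructor <;> simp [legendre]

theorem isSplit_left (α β : F) : IsSplit (legendre α β) α 0 β := by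
  constructor <;> simp [legendre]

theorem isSplit_right (α β : F) : IsSplit (legendre α β) β 0 α := by
  constructor <;> simp [legendre] <;> ring

namespace IsSplit

variable {W : WeierstrassCurve F} {e f g : F} (hW : IsSplit W e f g)
include hW

theorem equation_iff (x y : F) :
    W.toAffine.Equation x y ↔ y ^ 2 = (x - e) * (x - f) * (x - g) := by
  rw [WeierstrassCurve.Affine.equation_iff, hW.a₁, hW.a₂, hW.a₃, hW.a₄, hW.a₆]
  constructor <;> intro h <;> linear_combination h

theorem negY (x y : F) : W.toAffine.negY x y = -y := by
  simp [WeierstrassCurve.Affine.negY, hW.a₁, hW.a₃]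

theorem nonsingular (h2 : (2 : F) ≠ 0) (hef : e ≠ f) (heg : e ≠ g) (hfg : f ≠ g) {x y : F}
    (h : y ^ 2 = (x - e) * (x - f) * (x - g)) : W.toAffine.Nonsingular x y := by
  rw [WeierstrassCurve.Affine.nonsingular_iff, hW.equation_iff, hW.a₁, hW.a₂, hW.a₃, hW.a₄]
  refine ⟨h, ?_⟩
  by_cases hy : y = 0
  · left
    rw [hy] at h
    intro h0
    have h0' : (x - e) * (x - f) + (x - e) * (x - g) + (x - f) * (x - g) = 0 := by
      linear_combination -h0
    have h1 : (x - e) * (x - f) * (x - g) = 0 := by rw [← h]; ring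
    have hef' := sub_ne_zero.2 hef
    have heg' := sub_ne_zero.2 heg
    have hfg' := sub_ne_zero.2 hfg
    rcases mul_eq_zero.1 h1 with h1 | h1
    · rcases mul_eq_zero.1 h1 with h1 | h1
      · obtain rfl : x = e := sub_eq_zero.1 h1
        simp [hef', heg'] at h0'
      · obtain rfl : x = f := sub_eq_zero.1 h1
        simp [hfg', sub_ne_zero.2 hef.symm] at h0'
    · obtain rfl : x = g := sub_eq_zero.1 h1
      simp [sub_ne_zero.2 hfg.symm, sub_ne_zero.2 heg.symm] at h0'
  · right
    intro h0
    have : 2 * y = 0 := by linear_combination h0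
    simp [h2, hy] at this

end IsSplit

/-- The line through `P` and `Q` meets the curve in the points `P`, `Q` and `-(P + Q)`: an identity
of polynomials in the coordinate `t` along the line. -/
theorem IsSplit.line [DecidableEq F] {W : WeierstrassCurve F} {e f g : F} (hW : IsSplit W e f g)
    {x₁ y₁ x₂ y₂ x₃ y₃ : F} {h₁ : W.toAffine.Nonsingular x₁ y₁} {h₂ : W.toAffine.Nonsingular x₂ y₂}
    {h₃ : W.toAffine.Nonsingular x₃ y₃}
    (h : WeierstrassCurve.Affine.Point.some x₁ y₁ h₁ + .some x₂ y₂ h₂ + .some x₃ y₃ h₃ = 0) :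
    ∃ ℓ : F, (C ℓ * (X - C x₁) + C y₁) ^ 2 - (X - C e) * (X - C f) * (X - C g) =
      -((X - C x₁) * (X - C x₂) * (X - C x₃)) := by
  have hxy : ¬(x₁ = x₂ ∧ y₁ = W.toAffine.negY x₂ y₂) := by
    rintro ⟨hx, hy⟩
    rw [WeierstrassCurve.Affine.Point.add_of_Y_eq hx hy, zero_add] at h
    exact WeierstrassCurve.Affine.Point.some_ne_zero h₃ h
  refine ⟨W.toAffine.slope x₁ x₂ y₁ y₂, ?_⟩
  have key := WeierstrassCurve.Affine.addPolynomial_slope h₁.1 h₂.1 hxy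
  rw [add_eq_zero_iff_eq_neg, WeierstrassCurve.Affine.Point.add_some hxy,
    WeierstrassCurve.Affine.Point.neg_some, WeierstrassCurve.Affine.Point.some.injEq] at h
  rw [h.1] at key
  rw [← key, WeierstrassCurve.Affine.addPolynomial_eq, Cubic.toPoly]
  simp only [hW.a₁, hW.a₂, hW.a₃, hW.a₄, hW.a₆, map_neg, map_sub, map_add, map_mul, map_pow,
    map_one, map_ofNat, map_zero]
  ring

theorem IsSplit.line_e [DecidableEq F] {W : WeierstrassCurve F} {e f g : F} (hW : IsSplit W e f g)
    {x₁ y₁ x₂ y₂ x₃ y₃ : F} {h₁ : W.toAffine.Nonsingular x₁ y₁} {h₂ : W.toAffine.Nonsingular x₂ y₂}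
    {h₃ : W.toAffine.Nonsingular x₃ y₃}
    (h : WeierstrassCurve.Affine.Point.some x₁ y₁ h₁ + .some x₂ y₂ h₂ + .some x₃ y₃ h₃ = 0) :
    IsSquare ((x₁ - e) * (x₂ - e) * (x₃ - e)) := by
  obtain ⟨ℓ, hℓ⟩ := hW.line h
  have := congrArg (eval e) hℓ
  simp at this
  exact ⟨ℓ * (e - x₁) + y₁, by linear_combination -this⟩

/-- Translation by the point `(e, 0)` of order two. -/
theorem IsSplit.mul_of_add_eq [DecidableEq F] {W : WeierstrassCurve F} {e f g : F}
    (hW : IsSplit W e f g)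
    {y₁ x₂ y₂ x₃ y₃ : F} {h₁ : W.toAffine.Nonsingular e y₁} {h₂ : W.toAffine.Nonsingular x₂ y₂}
    {h₃ : W.toAffine.Nonsingular x₃ y₃}
    (h : WeierstrassCurve.Affine.Point.some e y₁ h₁ + .some x₂ y₂ h₂ + .some x₃ y₃ h₃ = 0) :
    (x₂ - e) * (x₃ - e) = (e - f) * (e - g) := by
  obtain ⟨ℓ, hℓ⟩ := hW.line h
  have hy : y₁ = 0 := by
    have := (hW.equation_iff _ _).1 h₁.1
    simpa using this
  have := congrArg (fun p => eval e (derivative p)) hℓ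
  simp [derivative_mul, hy, derivative_pow] at this
  linear_combination -this

/-- The components of the `2`-descent map of the curve `y² = (x - e) (x - f) (x - g)`: it represents
the class of `x - e` modulo squares, with the value `(e - f) (e - g)` where `x - e` vanishes. -/
def kummer {W : WeierstrassCurve F} (e f g : F) : W.toAffine.Point → F
  | .zero => 1
  | .some x _ _ => open Classical in if x = e then (e - f) * (e - g) else x - e

section kummer

variable {W : WeierstrassCurve F} {e f g : F}

@[simp]
theorem kummer_zero : kummer e f g (0 : W.toAffine.Point) = 1 := rfl

theorem kummer_some {x y : F} (h : W.toAffine.Nonsingular x y) (hx : x ≠ e) :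
    kummer e f g (.some x y h) = x - e := by
  simp [kummer, hx]

theorem kummer_some_self {y : F} (h : W.toAffine.Nonsingular e y) :
    kummer e f g (.some e y h) = (e - f) * (e - g) := by
  simp [kummer]

theorem kummer_neg (P : W.toAffine.Point) : kummer e f g (-P) = kummer e f g P := by
  rcases P with _ | ⟨x, y, h⟩ <;> rfl

theorem kummer_ne_zero (hef : e ≠ f) (heg : e ≠ g) (P : W.toAffine.Point) :
    kummer e f g P ≠ 0 := by
  rcases P with _ | ⟨x, y, h⟩
  · exact one_ne_zero
  · by_cases hx : x = e
    · subst hx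
      rw [kummer_some_self]
      exact mul_ne_zero (sub_ne_zero.2 hef) (sub_ne_zero.2 heg)
    · rw [kummer_some h hx]
      exact sub_ne_zero.2 hx

theorem IsSplit.isSquare_of_add_eq [DecidableEq F] (hW : IsSplit W e f g) {P Q R : W.toAffine.Point}
    (h : P + Q + R = 0) : IsSquare (kummer e f g P * kummer e f g Q * kummer e f g R) := by
  by_cases hP : P = 0
  · subst hP
    obtain rfl : R = -Q := by rw [zero_add] at h; exact (neg_eq_of_add_eq_zero_right h).symm
    exact ⟨kummer e f g Q, by rw [kummer_neg, kummer_zero]; ring⟩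
  by_cases hQ : Q = 0
  · subst hQ
    obtain rfl : R = -P := by rw [add_zero] at h; exact (neg_eq_of_add_eq_zero_right h).symm
    exact ⟨kummer e f g P, by rw [kummer_neg, kummer_zero]; ring⟩
  by_cases hR : R = 0
  · subst hR
    obtain rfl : Q = -P := by rw [add_zero] at h; exact (neg_eq_of_add_eq_zero_right h).symm
    exact ⟨kummer e f g P, by rw [kummer_neg, kummer_zero]; ring⟩
  -- Two of the three points cannot both have `x = e`, for then they are opposite.
  have aux : ∀ {P Q R : W.toAffine.Point}, P + Q + R = 0 → R ≠ 0 → ∀ {x₁ y₁ x₂ y₂ h₁ h₂},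
      P = .some x₁ y₁ h₁ → Q = .some x₂ y₂ h₂ → x₁ = e → x₂ ≠ e := by
    rintro P Q R h hR x₁ y₁ x₂ y₂ h₁ h₂ rfl rfl rfl rfl
    have e₁ := (hW.equation_iff _ _).1 h₁.1
    have e₂ := (hW.equation_iff _ _).1 h₂.1
    simp only [sub_self, zero_mul, ne_eq, OfNat.ofNat_ne_zero, not_false_eq_true,
      pow_eq_zero_iff] at e₁ e₂
    rw [WeierstrassCurve.Affine.Point.add_of_Y_eq rfl (by rw [hW.negY, e₁, e₂, neg_zero]),
      zero_add] at h
    exact hR h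
  -- The case of a point of order two.
  have aux' : ∀ {P Q R : W.toAffine.Point}, P + Q + R = 0 → P ≠ 0 → Q ≠ 0 → R ≠ 0 →
      ∀ {y₁ h₁}, P = .some e y₁ h₁ → kummer e f g Q * kummer e f g R = kummer e f g P := by
    rintro P Q R h hP hQ hR y₁ h₁ rfl
    rcases Q with _ | ⟨x₂, y₂, h₂⟩
    · exact absurd rfl hQ
    rcases R with _ | ⟨x₃, y₃, h₃⟩
    · exact absurd rfl hR
    have h' : WeierstrassCurve.Affine.Point.some e y₁ h₁ + .some x₃ y₃ h₃ + .some x₂ y₂ h₂ = 0 := by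
      rw [← h]; abel
    rw [kummer_some _ (aux h hR rfl rfl rfl), kummer_some _ (aux h' hQ rfl rfl rfl),
      kummer_some_self, hW.mul_of_add_eq h]
  rcases P with _ | ⟨x₁, y₁, h₁⟩
  · exact absurd rfl hP
  rcases Q with _ | ⟨x₂, y₂, h₂⟩
  · exact absurd rfl hQ
  rcases R with _ | ⟨x₃, y₃, h₃⟩
  · exact absurd rfl hR
  by_cases hx₁ : x₁ = e
  · subst hx₁
    rw [mul_assoc, aux' h hP hQ hR rfl]
    exact ⟨_, rfl⟩
  by_cases hx₂ : x₂ = e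
  · subst hx₂
    rw [mul_comm (kummer _ _ _ _), mul_assoc, aux' (by rw [← h]; abel) hQ hP hR rfl]
    exact ⟨_, rfl⟩
  by_cases hx₃ : x₃ = e
  · subst hx₃
    rw [aux' (by rw [← h]; abel) hR hP hQ rfl]
    exact ⟨_, rfl⟩
  rw [kummer_some _ hx₁, kummer_some _ hx₂, kummer_some _ hx₃]
  exact hW.line_e h

theorem IsSplit.isSquare_kummer_add [DecidableEq F] (hW : IsSplit W e f g)
    (P Q : W.toAffine.Point) :
    IsSquare (kummer e f g P * kummer e f g Q * kummer e f g (P + Q)) := by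
  rw [← kummer_neg (P + Q)]
  exact hW.isSquare_of_add_eq (by abel)

theorem isSquare_of_kummer {x y : F} {h : W.toAffine.Nonsingular x y}
    (hs : IsSquare (kummer e f g (.some x y h))) : IsSquare (x - e) := by
  by_cases hx : x = e
  · simp [hx]
  · rwa [kummer_some h hx] at hs

/-- A point is divisible by two if its image under the `2`-descent map is trivial. The half is given
by the classical formula in terms of square roots `s`, `t`, `u` of `x - e`, `x - f`, `x - g`. -/
theorem IsSplit.exists_half [DecidableEq F] (hW : IsSplit W e f g) (h2 : (2 : F) ≠ 0)
    (hef : e ≠ f) (heg : e ≠ g) (hfg : f ≠ g) {x y : F} {h : W.toAffine.Nonsingular x y}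
    (he : IsSquare (x - e)) (hf : IsSquare (x - f)) (hg : IsSquare (x - g)) :
    ∃ Q : W.toAffine.Point, Q + Q = .some x y h := by
  obtain ⟨s, hs⟩ := he
  obtain ⟨t, ht⟩ := hf
  obtain ⟨u, hu⟩ := hg
  have hst : s + t ≠ 0 := fun h0 => hef (by linear_combination ht - hs + (t - s) * h0)
  have hsu : s + u ≠ 0 := fun h0 => heg (by linear_combination hu - hs + (u - s) * h0)
  have htu : t + u ≠ 0 := fun h0 => hfg (by linear_combination hu - ht + (u - t) * h0)
  set X := x + s * t + s * u + t * u with hX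
  set Y := (s + t) * (s + u) * (t + u) with hY
  have hXe : X - e = (s + t) * (s + u) := by rw [hX]; linear_combination hs
  have hXf : X - f = (s + t) * (t + u) := by rw [hX]; linear_combination ht
  have hXg : X - g = (s + u) * (t + u) := by rw [hX]; linear_combination hu
  have hY0 : Y ≠ 0 := mul_ne_zero (mul_ne_zero hst hsu) htu
  have hQ : W.toAffine.Nonsingular X Y := by
    apply hW.nonsingular h2 hef heg hfg
    rw [hXe, hXf, hXg, hY]; ring
  have hYn : Y ≠ W.toAffine.negY X Y := by
    rw [hW.negY]
    intro h0
    exact mul_ne_zero h2 hY0 (by linear_combination h0)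
  have hslope : W.toAffine.slope X X Y Y = s + t + u := by
    rw [WeierstrassCurve.Affine.slope_of_Y_ne rfl hYn, hW.negY, hW.a₁, hW.a₂, hW.a₄]
    rw [div_eq_iff (by intro h0; exact mul_ne_zero h2 hY0 (by linear_combination h0))]
    have : 3 * X ^ 2 + 2 * -(e + f + g) * X + (e * f + e * g + f * g) - 0 * Y =
      (X - e) * (X - f) + (X - e) * (X - g) + (X - f) * (X - g) := by ring
    rw [this, hXe, hXf, hXg, hY]
    ring
  have hx : W.toAffine.addX X X (W.toAffine.slope X X Y Y) = x := by
    rw [hslope, WeierstrassCurve.Affine.addX, hW.a₁, hW.a₂, hX]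
    linear_combination -hs - ht - hu
  obtain ⟨y', h', hadd⟩ : ∃ y' h', WeierstrassCurve.Affine.Point.some X Y hQ + .some X Y hQ =
      .some (W.toAffine.addX X X (W.toAffine.slope X X Y Y)) y' h' :=
    ⟨_, _, WeierstrassCurve.Affine.Point.add_self_of_Y_ne hYn⟩
  rcases (WeierstrassCurve.Affine.Point.X_eq_iff (h₁ := h') (h₂ := h)).1 hx with h' | h'
  · exact ⟨_, hadd.trans h'⟩
  · exact ⟨-.some X Y hQ, by rw [← neg_add, hadd, h', neg_neg]⟩

end kummer

/-- The doubling formula. -/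
theorem IsSplit.double [DecidableEq F] {W : WeierstrassCurve F} {e f g : F} (hW : IsSplit W e f g)
    (h2 : (2 : F) ≠ 0) {x y x' y' : F} {h : W.toAffine.Nonsingular x y}
    {h' : W.toAffine.Nonsingular x' y'}
    (hadd : WeierstrassCurve.Affine.Point.some x y h + .some x y h = .some x' y' h') :
    y ≠ 0 ∧ (2 * y) ^ 2 * (x' - e) = ((x - e) ^ 2 - (e - f) * (e - g)) ^ 2 := by
  have hy : y ≠ 0 := by
    rintro rfl
    rw [WeierstrassCurve.Affine.Point.add_of_Y_eq rfl (by rw [hW.negY, neg_zero])] at hadd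
    exact WeierstrassCurve.Affine.Point.some_ne_zero h' hadd.symm
  refine ⟨hy, ?_⟩
  have hyn : y ≠ W.toAffine.negY x y := by
    rw [hW.negY]
    intro h0
    exact mul_ne_zero h2 hy (by linear_combination h0)
  have hx' := hadd
  rw [WeierstrassCurve.Affine.Point.add_self_of_Y_ne hyn,
    WeierstrassCurve.Affine.Point.some.injEq] at hx'
  have hs : W.toAffine.slope x x y y * (2 * y) =
      3 * x ^ 2 + 2 * -(e + f + g) * x + (e * f + e * g + f * g) := by
    rw [WeierstrassCurve.Affine.slope_of_Y_ne rfl hyn, hW.negY, hW.a₁, hW.a₂, hW.a₄]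
    rw [div_mul_eq_mul_div, div_eq_iff (by
      intro h0; exact mul_ne_zero h2 hy (by linear_combination h0))]
    ring
  have hy2 := (hW.equation_iff _ _).1 h.1
  rw [← hx'.1, WeierstrassCurve.Affine.addX, hW.a₁, hW.a₂]
  have : (W.toAffine.slope x x y y * (2 * y)) ^ 2 = (2 * y) ^ 2 * W.toAffine.slope x x y y ^ 2 := by
    ring
  rw [hs] at this
  linear_combination -this + (4 * (e + f + g) - 4 * e - 8 * x) * hy2

end

/-! ### Characters on square classes, and the pair `P + Q`, `P - Q` -/

section

open Polynomial

/-- A homomorphism from the multiplicative monoid of non-zero elements of `R` to `ℤ/2ℤ`, given by a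
function on `R` whose value at zero is irrelevant. -/
structure ParityChar (R : Type*) [CommRing R] where
  /-- The underlying function. -/
  toFun : R → ZMod 2
  map_mul' : ∀ x y, x ≠ 0 → y ≠ 0 → toFun (x * y) = toFun x + toFun y

namespace ParityChar

variable {R : Type*} [CommRing R]

instance : CoeFun (ParityChar R) fun _ => R → ZMod 2 := ⟨toFun⟩

variable (χ : ParityChar R)

theorem map_mul {x y : R} (hx : x ≠ 0) (hy : y ≠ 0) : χ (x * y) = χ x + χ y :=
  χ.map_mul' x y hx hy

theorem map_mul_self {x : R} (hx : x ≠ 0) : χ (x * x) = 0 := by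
  rw [χ.map_mul hx hx, CharTwo.add_self_eq_zero]

theorem map_sq {x : R} (hx : x ≠ 0) : χ (x ^ 2) = 0 := by
  rw [sq, χ.map_mul_self hx]

theorem map_of_isSquare {x : R} (hx : x ≠ 0) (h : IsSquare x) : χ x = 0 := by
  obtain ⟨y, rfl⟩ := h
  exact χ.map_mul_self (by rintro rfl; simp at hx)

theorem map_eq_of_isSquare_mul [NoZeroDivisors R] {x y : R} (hx : x ≠ 0) (hy : y ≠ 0)
    (h : IsSquare (x * y)) : χ x = χ y := by
  have := χ.map_of_isSquare (mul_ne_zero hx hy) h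
  rw [χ.map_mul hx hy] at this
  exact CharTwo.add_eq_zero.1 this

/-- The extension of a character from polynomials to rational functions. -/
def ratFunc {k : Type*} [Field k] (χ : ParityChar k[X]) : ParityChar (RatFunc k) where
  toFun f := χ f.num + χ f.denom
  map_mul' f g hf hg := by
    have h := congrArg χ (RatFunc.num_denom_mul f g)
    have nf := RatFunc.num_ne_zero hf
    have ng := RatFunc.num_ne_zero hg
    have nfg := RatFunc.num_ne_zero (mul_ne_zero hf hg)
    have df := RatFunc.denom_ne_zero f
    have dg := RatFunc.denom_ne_zero g
    have dfg := RatFunc.denom_ne_zero (f * g)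
    rw [χ.map_mul nfg (mul_ne_zero df dg), χ.map_mul df dg, χ.map_mul (mul_ne_zero nf ng) dfg,
      χ.map_mul nf ng] at h
    have two : ∀ z : ZMod 2, z + z = 0 := CharTwo.add_self_eq_zero
    linear_combination h + two (χ (f * g).denom) - two (χ f.denom) - two (χ g.denom)

theorem ratFunc_algebraMap {k : Type*} [Field k] (χ : ParityChar k[X]) (f : k[X]) :
    χ.ratFunc (algebraMap k[X] (RatFunc k) f) = χ f := by
  have : χ 1 = 0 := by simpa using χ.map_mul_self one_ne_zero
  simp [ratFunc, this]

/-- The parity of the order of vanishing of a polynomial at `t`. -/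
def order {k : Type*} [Field k] (t : k) : ParityChar k[X] where
  toFun f := (taylor t f).natTrailingDegree
  map_mul' f g hf hg := by
    rw [taylor_mul, natTrailingDegree_mul ((taylor_eq_zero t f).not.2 hf)
      ((taylor_eq_zero t g).not.2 hg), Nat.cast_add]

theorem order_of_eval_ne_zero {k : Type*} [Field k] {t : k} {f : k[X]} (h : f.eval t ≠ 0) :
    order t f = 0 := by
  have : (taylor t f).natTrailingDegree = 0 :=
    natTrailingDegree_eq_zero_of_constantCoeff_ne_zero (by simpa [taylor_coeff_zero] using h)
  simp [order, this]

theorem order_of_simple {k : Type*} [Field k] {t : k} {f : k[X]} (h : f.eval t = 0)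
    (h' : f.derivative.eval t ≠ 0) : order t f = 1 := by
  have : (taylor t f).natTrailingDegree = 1 := by
    apply le_antisymm
    · exact natTrailingDegree_le_of_ne_zero (by rwa [taylor_coeff_one])
    · refine le_natTrailingDegree ?_ fun m hm => ?_
      · intro h0
        rw [taylor_eq_zero] at h0
        simp [h0] at h'
      · obtain rfl : m = 0 := by omega
        rwa [taylor_coeff_zero]
  simp [order, this]

/-- The parity of the `p`-adic valuation of the leading coefficient at `t` of a polynomial, that is,
of the first non-zero coefficient of its expansion in powers of `X - t`. -/
def lead (t : ℚ) (p : ℕ) [Fact p.Prime] : ParityChar ℚ[X] where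
  toFun f := ((padicValRat p (taylor t f).trailingCoeff : ℤ) : ZMod 2)
  map_mul' f g hf hg := by
    rw [taylor_mul, trailingCoeff_mul, padicValRat.mul, Int.cast_add]
    · exact trailingCoeff_nonzero_iff_nonzero.2 ((taylor_eq_zero t f).not.2 hf)
    · exact trailingCoeff_nonzero_iff_nonzero.2 ((taylor_eq_zero t g).not.2 hg)

theorem lead_of_eval_ne_zero {t : ℚ} {p : ℕ} [Fact p.Prime] {f : ℚ[X]} (h : f.eval t ≠ 0) :
    lead t p f = ((padicValRat p (f.eval t) : ℤ) : ZMod 2) := by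
  have : (taylor t f).natTrailingDegree = 0 :=
    natTrailingDegree_eq_zero_of_constantCoeff_ne_zero (by simpa [taylor_coeff_zero] using h)
  simp [lead, trailingCoeff, this, taylor_coeff_zero]

theorem cast_padicValRat_eq_zero {p : ℕ} [Fact p.Prime] {x : ℚ} (h : IsSquare x) :
    ((padicValRat p x : ℤ) : ZMod 2) = 0 := by
  obtain ⟨y, rfl⟩ := h
  by_cases hy : y = 0
  · simp [hy]
  · rw [padicValRat.mul hy hy, Int.cast_add, CharTwo.add_self_eq_zero]

theorem cast_padicValRat {p : ℕ} [hp : Fact p.Prime] (k : ℕ) {m : ℤ} (h : ¬ (p : ℤ) ∣ m) :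
    ((padicValRat p ((p : ℚ) ^ k * m) : ℤ) : ZMod 2) = k := by
  have hm : (m : ℚ) ≠ 0 := by
    rintro h0
    exact h (by rw [Int.cast_eq_zero.1 h0]; exact dvd_zero _)
  rw [padicValRat.mul (pow_ne_zero _ (Nat.cast_ne_zero.2 hp.out.ne_zero)) hm, padicValRat.of_int,
    padicValInt.eq_zero_of_not_dvd h, padicValRat.pow]
  simp [padicValRat.self hp.out.one_lt]

/-- The homomorphism obtained by composing a component of the `2`-descent map with a character. -/
def onPoints {F : Type*} [Field F] [DecidableEq F] (χ : ParityChar F) {W : WeierstrassCurve F}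
    {e f g : F} (hW : IsSplit W e f g) (hef : e ≠ f) (heg : e ≠ g) :
    W.toAffine.Point →+ ZMod 2 :=
  AddMonoidHom.mk' (fun P => χ (kummer e f g P)) fun P Q => by
    have hP := kummer_ne_zero hef heg P
    have hQ := kummer_ne_zero hef heg Q
    have hPQ := kummer_ne_zero hef heg (P + Q)
    rw [← χ.map_mul hP hQ]
    exact (χ.map_eq_of_isSquare_mul (mul_ne_zero hP hQ) hPQ (hW.isSquare_kummer_add P Q)).symm

end ParityChar

open WeierstrassCurve.Affine in
/-- The `x`-coordinates of `P + Q` and `P - Q` for two points with distinct `x`-coordinates. -/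
theorem legendre_add_sub {F : Type*} [Field F] [DecidableEq F] {α β : F} {x₁ y₁ x₂ y₂ : F}
    {h₁ : (legendre α β).toAffine.Nonsingular x₁ y₁}
    {h₂ : (legendre α β).toAffine.Nonsingular x₂ y₂} (hx : x₁ ≠ x₂) :
    ∃ x y x' y' h h', Point.some x₁ y₁ h₁ + .some x₂ y₂ h₂ = .some x y h ∧
      Point.some x₁ y₁ h₁ - .some x₂ y₂ h₂ = .some x' y' h' ∧
      (x₁ - x₂) ^ 2 * (x * x') = (x₁ * x₂ - α * β) ^ 2 ∧
      (x₁ - x₂) ^ 2 * (x + x') =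
        2 * (x₁ * x₂ * (x₁ + x₂) - 2 * (α + β) * (x₁ * x₂) + α * β * (x₁ + x₂)) := by
  have hW := isSplit_zero α β
  have e₁ := (hW.equation_iff _ _).1 h₁.1
  have e₂ := (hW.equation_iff _ _).1 h₂.1
  have hd : x₁ - x₂ ≠ 0 := sub_ne_zero.2 hx
  refine ⟨_, _, _, _, _, nonsingular_add h₁ ((nonsingular_neg _ _).2 h₂) fun hxy => hx hxy.1,
    Point.add_of_X_ne hx, ?_, ?_, ?_⟩
  · rw [sub_eq_add_neg, Point.neg_some]
    exact Point.add_of_X_ne hx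
  · rw [slope_of_X_ne hx, slope_of_X_ne hx, hW.negY, addX, addX, hW.a₁, hW.a₂]
    apply mul_left_cancel₀ (pow_ne_zero 2 hd)
    set k := α + β - x₁ - x₂ with hk
    have hl : (y₁ - y₂) / (x₁ - x₂) * (x₁ - x₂) = y₁ - y₂ := div_mul_cancel₀ _ hd
    have hl' : (y₁ - -y₂) / (x₁ - x₂) * (x₁ - x₂) = y₁ + y₂ := by
      rw [div_mul_cancel₀ _ hd, sub_neg_eq_add]
    set l := (y₁ - y₂) / (x₁ - x₂)
    set l' := (y₁ - -y₂) / (x₁ - x₂)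
    have h3 : (l * (x₁ - x₂)) ^ 2 = (y₁ - y₂) ^ 2 := by rw [hl]
    have h4 : (l' * (x₁ - x₂)) ^ 2 = (y₁ + y₂) ^ 2 := by rw [hl']
    have h5 : ((l * (x₁ - x₂)) ^ 2 + k * (x₁ - x₂) ^ 2) * ((l' * (x₁ - x₂)) ^ 2 +
        k * (x₁ - x₂) ^ 2) = (x₁ - x₂) ^ 2 * (x₁ * x₂ - α * β) ^ 2 := by
      rw [h3, h4]
      linear_combination (y₁ ^ 2 + (x₁ - 0) * (x₁ - α) * (x₁ - β) - 2 * y₂ ^ 2 +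
        2 * k * (x₁ - x₂) ^ 2) * e₁ + (y₂ ^ 2 + (x₂ - 0) * (x₂ - α) * (x₂ - β) -
        2 * ((x₁ - 0) * (x₁ - α) * (x₁ - β)) + 2 * k * (x₁ - x₂) ^ 2) * e₂
    linear_combination h5
  · rw [slope_of_X_ne hx, slope_of_X_ne hx, hW.negY, addX, addX, hW.a₁, hW.a₂]
    field_simp
    linear_combination 2 * e₁ + 2 * e₂

/-- The quadratic map on `Sym² ℙ¹ = ℙ²` describing `(P, Q) ↦ (P + Q, P - Q)`. -/
theorem legendre_addSubMap_eval {F : Type*} [Field F] (α β : F) (v : Fin 3 → F) :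
    (fun i => ((legendre α β).addSubMap i).eval v) =
      ![v 0 ^ 2 - 2 * (α * β) * v 0 * v 2 + (α * β) ^ 2 * v 2 ^ 2,
        2 * v 1 * v 0 - 4 * (α + β) * v 0 * v 2 + 2 * (α * β) * v 1 * v 2,
        v 1 ^ 2 - 4 * v 0 * v 2] := by
  have hb : (legendre α β).b₂ = -4 * (α + β) ∧ (legendre α β).b₄ = 2 * (α * β) ∧
      (legendre α β).b₆ = 0 ∧ (legendre α β).b₈ = -(α * β) ^ 2 := by
    refine ⟨?_, ?_, ?_, ?_⟩ <;>
      simp only [legendre, WeierstrassCurve.b₂, WeierstrassCurve.b₄, WeierstrassCurve.b₆,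
        WeierstrassCurve.b₈] <;> ring
  obtain ⟨hb2, hb4, hb6, hb8⟩ := hb
  ext i
  fin_cases i <;> simp [WeierstrassCurve.addSubMap, hb2, hb4, hb6, hb8]
  ring

open WeierstrassCurve.Affine in
/-- The `x`-coordinates of `P + Q` and `P - Q` in terms of those of `P` and `Q`, for all pairs of
points, in terms of projective coordinates on `Sym² ℙ¹ = ℙ²`. -/
theorem addSubMap_sym2x {F : Type*} [Field F] [DecidableEq F] (h2 : (2 : F) ≠ 0) (α β : F)
    (P Q : (legendre α β).toAffine.Point) :
    ∃ c : F, (fun i => ((legendre α β).addSubMap i).eval (P.sym2x Q)) =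
      c • (P + Q).sym2x (P - Q) := by
  have hW := isSplit_zero α β
  rw [legendre_addSubMap_eval]
  have dbl : ∀ P : (legendre α β).toAffine.Point, P ≠ 0 → ∃ x c : F, P.xRep = ![x, 1] ∧
      ![(x ^ 2 - α * β) ^ 2, 4 * (x * (x - α) * (x - β)), 0] = c • (P + P).sym2x 0 := by
    rintro (_ | ⟨x, y, h⟩) hP
    · exact absurd rfl hP
    have e := (hW.equation_iff _ _).1 h.1
    rcases hPP : Point.some x y h + .some x y h with _ | ⟨x', y', h'⟩
    · refine ⟨x, (x ^ 2 - α * β) ^ 2, Point.xRep_some h, ?_⟩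
      have hy : y = 0 := by
        by_contra hy
        rw [Point.add_self_of_Y_ne] at hPP
        · exact Point.some_ne_zero _ hPP
        · rw [hW.negY]
          intro h0
          exact mul_ne_zero h2 hy (by linear_combination h0)
      subst hy
      rw [hPP, ← Point.zero_def, Point.sym2x_zero_zero]
      ext i
      fin_cases i <;> simp
      exact Or.inr (by simpa using e.symm)
    · refine ⟨x, (2 * y) ^ 2, Point.xRep_some h, ?_⟩
      have := (hW.double h2 hPP).2
      rw [hPP, Point.sym2x_some_zero]
      ext i
      fin_cases i <;> simp
      · linear_combination -this
      · linear_combination -4 * e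
  rcases P with _ | ⟨x₁, y₁, h₁⟩
  · rw [← Point.zero_def, zero_add, zero_sub]
    rcases Q with _ | ⟨x₂, y₂, h₂⟩
    · exact ⟨1, by ext i; fin_cases i <;> simp [← Point.zero_def]⟩
    · exact ⟨1, by ext i; fin_cases i <;> simp <;> ring⟩
  rcases Q with _ | ⟨x₂, y₂, h₂⟩
  · exact ⟨1, by ext i; fin_cases i <;> simp [← Point.zero_def] <;> ring⟩
  by_cases hx : x₁ = x₂
  · obtain ⟨x, c, hx', hc⟩ := dbl (.some x₁ y₁ h₁) (Point.some_ne_zero h₁)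
    obtain rfl : x₁ = x := by simpa using congrFun hx' 0
    subst hx
    have hsum : (Point.some x₁ y₁ h₁ + .some x₁ y₂ h₂).sym2x (.some x₁ y₁ h₁ - .some x₁ y₂ h₂) =
        (Point.some x₁ y₁ h₁ + .some x₁ y₁ h₁).sym2x 0 := by
      rcases Point.X_eq_iff (h₁ := h₁) (h₂ := h₂) |>.1 rfl with h | h
      · rw [← h, sub_self]
      · rw [h, neg_add_cancel, sub_eq_add_neg, ← neg_add, Point.sym2x_neg_right, Point.sym2x_comm,
          Point.sym2x_neg_left]
    refine ⟨c, ?_⟩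
    rw [hsum, ← hc]
    ext i
    fin_cases i <;> simp <;> ring
  · obtain ⟨x, y, x', y', h, h', hadd, hsub, hm, ha⟩ := legendre_add_sub (h₁ := h₁) (h₂ := h₂) hx
    refine ⟨(x₁ - x₂) ^ 2, ?_⟩
    rw [hadd, hsub]
    ext i
    fin_cases i <;> simp
    · linear_combination -hm
    · linear_combination -ha
    · ring

end

/-! ### The curve, its known points and their square classes -/

section

open Polynomial WeierstrassCurve.Affine

/-- The root `α` of the cubic `x (x - α) (x - β)` defining the model. -/
def rootα : ℚ[X] := 243 * X ^ 2 * (16 + 9 * X) * (20 + 3 * X)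

/-- The root `β` of the cubic `x (x - α) (x - β)` defining the model. -/
def rootβ : ℚ[X] := (80 + 9 * X) * (-4 + 9 * X) * (320 + 81 * X ^ 2)

theorem rootα_sub_rootβ : rootα - rootβ = 320 * (-20 + 9 * X) * (-16 + 27 * X) := by
  rw [rootα, rootβ]; ring

/-- The embedding of polynomials into rational functions. -/
abbrev ι : ℚ[X] →+* Qa := algebraMap ℚ[X] (RatFunc ℚ)

theorem ι_injective : Function.Injective ι := RatFunc.algebraMap_injective ℚ

theorem ι_X : ι X = a := RatFunc.algebraMap_X

theorem ι_ne_zero {f : ℚ[X]} (h : f ≠ 0) : ι f ≠ 0 := RatFunc.algebraMap_ne_zero h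

theorem ne_zero_of_eval {f : ℚ[X]} (t : ℚ) (h : f.eval t ≠ 0) : f ≠ 0 := by
  rintro rfl
  simp at h

theorem rootα_ne_zero : rootα ≠ 0 := ne_zero_of_eval 1 (by simp [rootα]; norm_num)

theorem rootβ_ne_zero : rootβ ≠ 0 := ne_zero_of_eval 1 (by simp [rootβ]; norm_num)

theorem rootα_ne_rootβ : rootα ≠ rootβ :=
  sub_ne_zero.1 (ne_zero_of_eval 1 (by rw [rootα_sub_rootβ]; simp; norm_num))

/-- The model `y² = x (x - α) (x - β)` over `ℚ(a)`. -/
abbrev E : WeierstrassCurve Qa := legendre (ι rootα) (ι rootβ)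

theorem E₀ : IsSplit E 0 (ι rootα) (ι rootβ) := isSplit_zero _ _

theorem Eα : IsSplit E (ι rootα) 0 (ι rootβ) := isSplit_left _ _

theorem Eβ : IsSplit E (ι rootβ) 0 (ι rootα) := isSplit_right _ _

theorem ια_ne : ι rootα ≠ 0 := ι_ne_zero rootα_ne_zero

theorem ιβ_ne : ι rootβ ≠ 0 := ι_ne_zero rootβ_ne_zero

theorem ια_ne_ιβ : ι rootα ≠ ι rootβ := ι_injective.ne rootα_ne_rootβ

theorem two_ne : (2 : Qa) ≠ 0 := two_ne_zero

theorem E_nonsingular {x y : Qa} (h : y ^ 2 = x * (x - ι rootα) * (x - ι rootβ)) :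
    E.toAffine.Nonsingular x y :=
  E₀.nonsingular two_ne ια_ne.symm ιβ_ne.symm ια_ne_ιβ (by rw [h, sub_zero])

/-- The point of the model with given polynomial coordinates. -/
def point (x y : ℚ[X]) (h : y ^ 2 = x * (x - rootα) * (x - rootβ)) : E.toAffine.Point :=
  .some (ι x) (ι y) (E_nonsingular (by rw [← map_pow, h]; simp))

variable {x y : ℚ[X]} (h : y ^ 2 = x * (x - rootα) * (x - rootβ))

theorem kummer_point_zero (hx : x ≠ 0) : kummer 0 (ι rootα) (ι rootβ) (point x y h) = ι x := by
  rw [point, kummer_some _ (ι_ne_zero hx), sub_zero]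

theorem kummer_point_α (hx : x ≠ rootα) :
    kummer (ι rootα) 0 (ι rootβ) (point x y h) = ι (x - rootα) := by
  rw [point, kummer_some _ (ι_injective.ne hx), map_sub]

/-- The point of order two with `x = 0`. -/
def T₁ : E.toAffine.Point := point 0 0 (by ring)

/-- The point of order two with `x = α`. -/
def T₂ : E.toAffine.Point := point rootα 0 (by ring)

/-- The point with `x = x₁`. -/
def P₁ : E.toAffine.Point :=
  point (81 * X ^ 2 * (-4 + 9 * X) * (80 + 9 * X))
    (51840 * X ^ 2 * (-4 + 9 * X) * (80 + 9 * X)) (by rw [rootα, rootβ]; ring)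

/-- The point with `x = x₂`. -/
def P₂ : E.toAffine.Point :=
  point (27 * X * (20 + 3 * X) * (-4 + 9 * X) * (80 + 9 * X))
    (540 * X * (20 + 3 * X) * (-4 + 9 * X) * (80 + 9 * X) * (-16 + 27 * X))
    (by rw [rootα, rootβ]; ring)

/-- The point with `x = x₄`. -/
def P₄ : E.toAffine.Point :=
  point (3 * (20 + 3 * X) * (-4 + 9 * X) * (320 + 81 * X ^ 2))
    (60 * (20 + 3 * X) * (-8 + 9 * X) * (-4 + 9 * X) * (320 + 81 * X ^ 2))
    (by rw [rootα, rootβ]; ring)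

/-- The half of the difference of two of the given points: `P₁ + 2 R` is a point with `x = x₃`. -/
def R : E.toAffine.Point :=
  point (9 * X * (80 + 9 * X) * (320 + 81 * X ^ 2))
    (36 * X * (80 + 9 * X) * (320 + 81 * X ^ 2) * (80 - 9 * X)) (by rw [rootα, rootβ]; ring)

/-- Generators of `E(ℚ(a))` modulo `2 E(ℚ(a))`. -/
def gen : Fin 6 → E.toAffine.Point := ![P₁, P₂, R, P₄, T₁, T₂]

/-- Representatives of the classes of `x` modulo squares for the points `gen i`. -/
def class₀ : Fin 6 → ℚ[X] :=
  ![(-4 + 9 * X) * (80 + 9 * X),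
    3 * X * (20 + 3 * X) * (-4 + 9 * X) * (80 + 9 * X),
    X * (80 + 9 * X) * (320 + 81 * X ^ 2),
    3 * (20 + 3 * X) * (-4 + 9 * X) * (320 + 81 * X ^ 2),
    3 * (16 + 9 * X) * (20 + 3 * X) * (80 + 9 * X) * (-4 + 9 * X) * (320 + 81 * X ^ 2),
    3 * (16 + 9 * X) * (20 + 3 * X)]

/-- Representatives of the classes of `x - α` modulo squares for the points `gen i`. -/
def classα : Fin 6 → ℚ[X] :=
  ![-5, 15 * X * (20 + 3 * X) * (-16 + 27 * X), X, -15 * (20 + 3 * X),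
    -3 * (16 + 9 * X) * (20 + 3 * X),
    15 * (16 + 9 * X) * (20 + 3 * X) * (-20 + 9 * X) * (-16 + 27 * X)]

theorem class₀_ne_zero (i : Fin 6) : class₀ i ≠ 0 := by
  apply ne_zero_of_eval 1
  fin_cases i <;> simp [class₀] <;> norm_num

theorem classα_ne_zero (i : Fin 6) : classα i ≠ 0 := by
  apply ne_zero_of_eval 1
  fin_cases i <;> simp [classα] <;> norm_num

theorem kummer_T₁_zero : kummer 0 (ι rootα) (ι rootβ) T₁ = ι (rootα * rootβ) := by
  have : T₁ = .some 0 (ι 0) (E_nonsingular (by simp)) := by simp [T₁, point]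
  rw [this, kummer_some_self, map_mul]
  ring

theorem kummer_T₂_α :
    kummer (ι rootα) 0 (ι rootβ) T₂ = ι (rootα * (rootα - rootβ)) := by
  rw [T₂, point, kummer_some_self]
  simp

/-- A character takes the same value on a polynomial and on its class representative. -/
theorem ratFunc_eq_of_mul_sq (χ : ParityChar ℚ[X]) {f g s : ℚ[X]} (hg : g ≠ 0) (hs : s ≠ 0)
    (h : f = g * s ^ 2) : χ.ratFunc (ι f) = χ g := by
  rw [χ.ratFunc_algebraMap, h, χ.map_mul hg (pow_ne_zero 2 hs), χ.map_sq hs, add_zero]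

variable [DecidableEq Qa]

/-- The characters of `E(ℚ(a))` obtained from the class of `x` modulo squares. -/
def char₀ (χ : ParityChar ℚ[X]) : E.toAffine.Point →+ ZMod 2 :=
  χ.ratFunc.onPoints E₀ ια_ne.symm ιβ_ne.symm

/-- The characters of `E(ℚ(a))` obtained from the class of `x - α` modulo squares. -/
def charα (χ : ParityChar ℚ[X]) : E.toAffine.Point →+ ZMod 2 :=
  χ.ratFunc.onPoints Eα ια_ne ια_ne_ιβ

theorem char₀_apply (χ : ParityChar ℚ[X]) (P : E.toAffine.Point) :
    char₀ χ P = χ.ratFunc (kummer 0 (ι rootα) (ι rootβ) P) := rfl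

theorem charα_apply (χ : ParityChar ℚ[X]) (P : E.toAffine.Point) :
    charα χ P = χ.ratFunc (kummer (ι rootα) 0 (ι rootβ) P) := rfl

theorem char₀_gen (χ : ParityChar ℚ[X]) (i : Fin 6) : char₀ χ (gen i) = χ (class₀ i) := by
  have key : ∀ i, ∃ f s : ℚ[X], kummer 0 (ι rootα) (ι rootβ) (gen i) = ι f ∧ s.eval 1 ≠ 0 ∧
      f = class₀ i * s ^ 2 := by
    intro i
    fin_cases i
    · refine ⟨81 * X ^ 2 * (-4 + 9 * X) * (80 + 9 * X), 9 * X, ?_, by simp, ?_⟩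
      · exact kummer_point_zero (by rw [rootα, rootβ]; ring) (ne_zero_of_eval 1 (by simp; norm_num))
      · simp [class₀]; ring
    · exact ⟨_, 3, kummer_point_zero (by rw [rootα, rootβ]; ring)
        (ne_zero_of_eval 1 (by simp; norm_num)), by simp, by simp [class₀]; ring⟩
    · exact ⟨_, 3, kummer_point_zero (by rw [rootα, rootβ]; ring)
        (ne_zero_of_eval 1 (by simp; norm_num)), by simp, by simp [class₀]; ring⟩
    · exact ⟨_, 1, kummer_point_zero (by rw [rootα, rootβ]; ring)
        (ne_zero_of_eval 1 (by simp; norm_num)), by simp, by simp [class₀]⟩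
    · exact ⟨_, 9 * X, kummer_T₁_zero, by simp, by simp [class₀, rootα, rootβ]; ring⟩
    · exact ⟨_, 9 * X, kummer_point_zero (by ring) rootα_ne_zero, by simp,
        by simp [class₀, rootα]; ring⟩
  obtain ⟨f, s, hf, hs, h⟩ := key i
  rw [char₀_apply, hf]
  exact ratFunc_eq_of_mul_sq χ (class₀_ne_zero i) (ne_zero_of_eval 1 hs) h

theorem charα_gen (χ : ParityChar ℚ[X]) (i : Fin 6) : charα χ (gen i) = χ (classα i) := by
  have key : ∀ i, ∃ f s : ℚ[X], kummer (ι rootα) 0 (ι rootβ) (gen i) = ι f ∧ s.eval 1 ≠ 0 ∧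
      f = classα i * s ^ 2 := by
    intro i
    fin_cases i
    · refine ⟨81 * X ^ 2 * (-4 + 9 * X) * (80 + 9 * X) - rootα, 144 * X, ?_, by simp, ?_⟩
      · exact kummer_point_α (by rw [rootα, rootβ]; ring)
          (sub_ne_zero.1 (ne_zero_of_eval 1 (by simp [rootα]; norm_num)))
      · simp [classα, rootα]; ring
    · exact ⟨_, 6, kummer_point_α (by rw [rootα, rootβ]; ring)
        (sub_ne_zero.1 (ne_zero_of_eval 1 (by simp [rootα]; norm_num))),
        by simp, by simp [classα, rootα]; ring⟩
    · exact ⟨_, 6 * (80 - 9 * X), kummer_point_α (by rw [rootα, rootβ]; ring)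
        (sub_ne_zero.1 (ne_zero_of_eval 1 (by simp [rootα]; norm_num))),
        by simp; norm_num, by simp [classα, rootα]; ring⟩
    · exact ⟨_, 2 * (-8 + 9 * X), kummer_point_α (by rw [rootα, rootβ]; ring)
        (sub_ne_zero.1 (ne_zero_of_eval 1 (by simp [rootα]; norm_num))),
        by simp; norm_num, by simp [classα, rootα]; ring⟩
    · exact ⟨_, 9 * X, kummer_point_α (by ring) rootα_ne_zero.symm, by simp,
        by simp [classα, rootα]; ring⟩
    · exact ⟨_, 72 * X, kummer_T₂_α, by simp,
        by rw [rootα_sub_rootβ]; simp [classα, rootα]; ring⟩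
  obtain ⟨f, s, hf, hs, h⟩ := key i
  rw [charα_apply, hf]
  exact ratFunc_eq_of_mul_sq χ (classα_ne_zero i) (ne_zero_of_eval 1 hs) h

end

/-! ### Characters separating the known points -/

section

open Polynomial WeierstrassCurve.Affine

instance fact_prime_five : Fact (Nat.Prime 5) := ⟨by norm_num⟩

instance fact_prime_seven : Fact (Nat.Prime 7) := ⟨by norm_num⟩

instance fact_prime_nineteen : Fact (Nat.Prime 19) := ⟨by norm_num⟩

theorem ParityChar.lead_of_eval_eq {t : ℚ} {p : ℕ} [Fact p.Prime] {f : ℚ[X]} (n : ℤ) (hn : n ≠ 0)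
    (h : f.eval t = n) : lead t p f = (padicValInt p n : ZMod 2) := by
  rw [lead_of_eval_ne_zero (by rw [h]; exact_mod_cast hn), h, padicValRat.of_int, Int.cast_natCast]

variable [DecidableEq Qa]

/-- Parities of orders of vanishing of `x - α` and `x` at places of bad reduction. -/
def orderChar : Fin 6 → E.toAffine.Point →+ ZMod 2 :=
  ![charα (.order 0), charα (.order (-16 / 9)), charα (.order (-20 / 3)), charα (.order (20 / 9)),
    charα (.order (16 / 27)), char₀ (.order (4 / 9))]

/-- Parities of `p`-adic valuations of the leading coefficients of `x - α` and `x` at the place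
`a = -2` of good reduction. -/
def leadChar : Fin 6 → E.toAffine.Point →+ ZMod 2 :=
  ![charα (.lead (-2) 2), char₀ (.lead (-2) 3), charα (.lead (-2) 5), char₀ (.lead (-2) 7),
    charα (.lead (-2) 7), charα (.lead (-2) 19)]

/-- The values of the characters `orderChar` on the points `gen`. -/
def orderMatrix : Matrix (Fin 6) (Fin 6) (ZMod 2) :=
  !![0, 1, 1, 0, 0, 0; 0, 0, 0, 0, 1, 1; 0, 1, 0, 1, 1, 1; 0, 0, 0, 0, 0, 1; 0, 1, 0, 0, 0, 1;
    1, 1, 0, 1, 1, 0]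

/-- The values of the characters `leadChar` on the points `gen`. -/
def leadMatrix : Matrix (Fin 6) (Fin 6) (ZMod 2) :=
  !![0, 1, 1, 1, 0, 0; 0, 1, 0, 1, 1, 1; 1, 0, 0, 1, 0, 0; 0, 1, 1, 0, 0, 1; 0, 0, 0, 1, 1, 0;
    0, 0, 0, 0, 0, 1]

theorem orderChar_gen (k i : Fin 6) : orderChar k (gen i) = orderMatrix k i := by
  fin_cases k <;> simp only [orderChar, Matrix.cons_val, Fin.reduceFinMk, Fin.zero_eta,
    Fin.mk_one, Fin.isValue, charα_gen, char₀_gen] <;> fin_cases i <;>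
  first
  | exact ParityChar.order_of_eval_ne_zero (by simp [class₀, classα]; try norm_num)
  | exact ParityChar.order_of_simple (by simp [class₀, classα]; try norm_num)
      (by simp [class₀, classα]; try norm_num)

theorem leadChar_gen (k i : Fin 6) : leadChar k (gen i) = leadMatrix k i := by
  have h₀ : ∀ (p : ℕ) [Fact p.Prime] (i : Fin 6), ParityChar.lead (-2) p (class₀ i) =
      (padicValInt p (![-1364, 114576, -79856, -595056, 73786944, -84] i) : ZMod 2) := by
    intro p _ i
    fin_cases i <;> exact ParityChar.lead_of_eval_eq _ (by simp) (by simp [class₀]; try norm_num)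
  have hα : ∀ (p : ℕ) [Fact p.Prime] (i : Fin 6), ParityChar.lead (-2) p (classα i) =
      (padicValInt p (![-5, 29400, -2, -210, 84, -1117200] i) : ZMod 2) := by
    intro p _ i
    fin_cases i <;> exact ParityChar.lead_of_eval_eq _ (by simp) (by simp [classα]; try norm_num)
  fin_cases k <;> simp only [leadChar, Matrix.cons_val, Fin.reduceFinMk, Fin.zero_eta,
    Fin.mk_one, Fin.isValue, charα_gen, char₀_gen, h₀, hα] <;> fin_cases i <;>
  decide +kernel

end

/-! ### Growth of denominators under doubling -/

section

open Polynomial WeierstrassCurve.Affine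

theorem isSquare_of_ι {f : ℚ[X]} (h : IsSquare (ι f)) : IsSquare f := by
  obtain ⟨r, hr⟩ := h
  obtain ⟨s, hs⟩ := IsIntegrallyClosed.exists_algebraMap_eq_of_isIntegral_pow (R := ℚ[X])
    (x := r) (n := 2) two_pos (by rw [sq, ← hr]; exact isIntegral_algebraMap)
  refine ⟨s, ι_injective ?_⟩
  rw [hr, map_mul]
  exact congrArg₂ _ hs.symm hs.symm

/-- The coordinates of a rational point in lowest terms: the denominators of `x` and `y` are `q ^ 2`
and `q ^ 3`. -/
theorem exists_lowest_terms {x y : Qa} (h : E.toAffine.Nonsingular x y) :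
    ∃ q n : ℚ[X], q.Monic ∧ x.denom = q ^ 2 ∧ IsCoprime x.num q ∧ y = ι n / ι q ^ 3 ∧
      n ^ 2 = x.num * (x.num - rootα * q ^ 2) * (x.num - rootβ * q ^ 2) := by
  have hxy := (E₀.equation_iff _ _).1 h.1
  set p := x.num with hp
  set d := x.denom with hd
  set m := y.num with hm
  set d' := y.denom with hd'
  have hcop : IsCoprime p d := RatFunc.isCoprime_num_denom x
  have hcop' : IsCoprime m d' := RatFunc.isCoprime_num_denom y
  have hd0 : ι d ≠ 0 := ι_ne_zero (RatFunc.denom_ne_zero x)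
  have hd0' : ι d' ≠ 0 := ι_ne_zero (RatFunc.denom_ne_zero y)
  have hx : x = ι p / ι d := (RatFunc.num_div_denom x).symm
  have hy : y = ι m / ι d' := (RatFunc.num_div_denom y).symm
  set N := p * (p - rootα * d) * (p - rootβ * d) with hN
  have key : m ^ 2 * d ^ 3 = d' ^ 2 * N := by
    apply ι_injective
    rw [hx, hy] at hxy
    simp only [map_mul, map_pow, map_sub, hN]
    field_simp at hxy
    linear_combination hxy
  have c1 : IsCoprime (p - rootα * d) d := by
    simpa [sub_eq_add_neg] using hcop.add_mul_right_left (-rootα)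
  have c2 : IsCoprime (p - rootβ * d) d := by
    simpa [sub_eq_add_neg] using hcop.add_mul_right_left (-rootβ)
  have cN : IsCoprime N d := (hcop.mul_left c1).mul_left c2
  have h1 : d ^ 3 ∣ d' ^ 2 := cN.symm.pow_left.dvd_of_dvd_mul_right ⟨m ^ 2, by rw [← key]; ring⟩
  have h2 : d' ^ 2 ∣ d ^ 3 :=
    (hcop'.symm.pow (m := 2) (n := 2)).dvd_of_dvd_mul_left ⟨N, by rw [key]⟩
  have hdm : d.Monic := RatFunc.monic_denom x
  have hdm' : d'.Monic := RatFunc.monic_denom y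
  have h3 : d ^ 3 = d' ^ 2 :=
    eq_of_monic_of_associated (hdm.pow 3) (hdm'.pow 2) (associated_of_dvd_dvd h1 h2)
  have h4 : d ∣ d' := by
    rw [← IsIntegrallyClosed.pow_dvd_pow_iff two_ne_zero, ← h3]
    exact pow_dvd_pow d (by norm_num)
  obtain ⟨q, hq⟩ := h4
  have hdq : d = q ^ 2 := by
    rw [hq] at h3
    exact mul_left_cancel₀ (pow_ne_zero 2 hdm.ne_zero) (by linear_combination h3)
  have hqm : q.Monic := hdm.of_mul_monic_left (by rw [← hq]; exact hdm')
  refine ⟨q, m, hqm, hdq, ?_, ?_, ?_⟩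
  · rw [hdq] at hcop
    exact (IsCoprime.pow_right_iff two_pos).1 hcop
  · rw [hy, hq, hdq]
    simp only [map_mul, map_pow]
    ring
  · rw [← hdq]
    apply mul_left_cancel₀ (pow_ne_zero 2 hdm'.ne_zero)
    rw [← hN, ← key, h3]
    ring

/-- If a point is divisible by two, then its `x - e` is a square for each root `e` of the cubic. -/
theorem isSquare_of_double [DecidableEq Qa] {e f g : Qa} (hE : IsSplit E e f g) (hef : e ≠ f)
    (heg : e ≠ g) {x y : Qa} {h : E.toAffine.Nonsingular x y} {Q : E.toAffine.Point}
    (hQ : Q + Q = .some x y h) : IsSquare (x - e) := by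
  have h1 := hE.isSquare_kummer_add Q Q
  rw [hQ] at h1
  obtain ⟨s, hs⟩ := h1
  have hk := kummer_ne_zero hef heg Q
  refine isSquare_of_kummer (f := f) (g := g) (h := h) ⟨s / kummer e f g Q, ?_⟩
  field_simp
  linear_combination hs

theorem separable_linear {b c : ℚ} (hc : c ≠ 0) : (C b + C c * X : ℚ[X]).Separable := by
  rw [separable_def]
  refine ⟨0, C c⁻¹, ?_⟩
  simp [← C_mul, hc]

theorem isCoprime_of_eq_C {f g u v : ℚ[X]} {c : ℚ} (hc : c ≠ 0) (h : u * f + v * g = C c) :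
    IsCoprime f g :=
  ⟨C c⁻¹ * u, C c⁻¹ * v, by
    rw [mul_assoc, mul_assoc, ← mul_add, h, ← C_mul, inv_mul_cancel₀ hc, C_1]⟩

theorem squarefree_rootβ : Squarefree rootβ := by
  have h1 : (80 + 9 * X : ℚ[X]).Separable := separable_linear (b := 80) (c := 9) (by norm_num)
  have h2 : (-4 + 9 * X : ℚ[X]).Separable := by
    have := separable_linear (b := -4) (c := 9) (by norm_num)
    rwa [C_neg] at this
  have h3 : (320 + 81 * X ^ 2 : ℚ[X]).Separable := by
    rw [separable_def]
    refine isCoprime_of_eq_C (u := 2) (v := -X) (c := 640) (by norm_num) ?_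
    simp only [derivative_add, derivative_mul, derivative_X_sq, derivative_ofNat, C_ofNat]
    ring
  refine ((h1.mul h2 ?_).mul h3 (IsCoprime.mul_left ?_ ?_)).squarefree
  · exact isCoprime_of_eq_C (u := 1) (v := -1) (c := 84) (by norm_num) (by rw [C_ofNat]; ring)
  · exact isCoprime_of_eq_C (u := -(9 * X - 80)) (v := 1) (c := 6720) (by norm_num)
      (by rw [C_ofNat]; ring)
  · exact isCoprime_of_eq_C (u := -(9 * X + 4)) (v := 1) (c := 336) (by norm_num)
      (by rw [C_ofNat]; ring)

theorem squarefree_rootα_sub_rootβ : Squarefree (rootα - rootβ) := by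
  have h1 : (-6400 + 2880 * X : ℚ[X]).Separable := by
    have := separable_linear (b := -6400) (c := 2880) (by norm_num)
    rwa [C_neg] at this
  have h2 : (-16 + 27 * X : ℚ[X]).Separable := by
    have := separable_linear (b := -16) (c := 27) (by norm_num)
    rwa [C_neg] at this
  have := (h1.mul h2 (isCoprime_of_eq_C (u := -3) (v := 320) (c := 14080) (by norm_num)
    (by rw [C_ofNat]; ring))).squarefree
  rw [rootα_sub_rootβ]
  convert this using 1
  ring

theorem dvd_X_of_sq_dvd_rootα {π : ℚ[X]} (hπ : Prime π) (h : π ^ 2 ∣ rootα) : π ∣ X := by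
  by_contra hX
  have h1 : (3888 + 2187 * X : ℚ[X]).Separable :=
    separable_linear (b := 3888) (c := 2187) (by norm_num)
  have h2 : (20 + 3 * X : ℚ[X]).Separable := separable_linear (b := 20) (c := 3) (by norm_num)
  have hs := (h1.mul h2 (isCoprime_of_eq_C (u := -1) (v := 729) (c := 10692) (by norm_num)
    (by rw [C_ofNat]; ring))).squarefree
  have h3 : π ^ 2 ∣ X ^ 2 * ((3888 + 2187 * X) * (20 + 3 * X)) := by
    convert h using 1
    rw [rootα]
    ring
  have := (IsCoprime.pow (m := 2) (n := 2)
    ((hπ.irreducible.coprime_iff_not_dvd).2 hX)).dvd_of_dvd_mul_left h3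
  rw [sq] at this
  exact hπ.not_isUnit (hs π this)

/-- The heart of the growth of denominators under doubling: for a point whose `x`, `x - α`, `x - β`
are the squares of `σ / q`, `τ / q`, `υ / q`, numerator and denominator of the doubling formula can
only have the prime factor `X` in common, and only if `X` divides `σ` and not `q`. -/
theorem prime_dvd_double {σ τ υ q π : ℚ[X]} (hτ : τ ^ 2 = σ ^ 2 - rootα * q ^ 2)
    (hυ : υ ^ 2 = σ ^ 2 - rootβ * q ^ 2) (hcop : IsCoprime σ q) (hπ : Prime π)
    (hN : π ∣ σ ^ 4 - rootα * rootβ * q ^ 4) (hD : π ∣ σ * τ * υ * q) :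
    π ∣ X ∧ π ∣ σ ∧ ¬ π ∣ q := by
  have hσq : ¬ (π ∣ σ ∧ π ∣ q) := fun h => hπ.not_isUnit (hcop.isUnit_of_dvd' h.1 h.2)
  have hq : ¬ π ∣ q := by
    intro hq
    refine hσq ⟨?_, hq⟩
    have : π ∣ σ ^ 4 := by
      have := dvd_add hN (dvd_mul_of_dvd_right (dvd_pow hq (four_ne_zero)) (rootα * rootβ))
      simpa using this
    exact hπ.dvd_of_dvd_pow this
  have hq2 : ∀ {f k}, π ∣ f * q ^ k → π ∣ f := fun {f k} h =>
    (hπ.dvd_or_dvd h).resolve_right fun h => hq (hπ.dvd_of_dvd_pow h)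
  have hq3 : ∀ {f}, π ^ 2 ∣ f * q ^ 2 → π ^ 2 ∣ f := fun {f} h =>
    (IsCoprime.pow ((hπ.irreducible.coprime_iff_not_dvd).2 hq)).dvd_of_dvd_mul_right h
  -- `π` divides two of `σ`, `τ`, `υ` and hence its square divides a difference of roots.
  have h1 : π ∣ σ → π ∣ τ → π ∣ X := fun hs ht => dvd_X_of_sq_dvd_rootα hπ (hq3 (by
    have := dvd_sub (pow_dvd_pow_of_dvd hs 2) (pow_dvd_pow_of_dvd ht 2)
    rwa [hτ, sub_sub_cancel] at this))
  have hsq : ∀ {f}, Squarefree f → ¬ π ^ 2 ∣ f := fun {f} hf h =>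
    hπ.not_isUnit (hf π (by rwa [← sq]))
  have h2 : π ∣ σ → ¬ π ∣ υ := fun hs ht => hsq squarefree_rootβ (hq3 (by
    have := dvd_sub (pow_dvd_pow_of_dvd hs 2) (pow_dvd_pow_of_dvd ht 2)
    rwa [hυ, sub_sub_cancel] at this))
  have h3 : π ∣ τ → ¬ π ∣ υ := fun hs ht => hsq squarefree_rootα_sub_rootβ (hq3 (by
    have := dvd_sub (pow_dvd_pow_of_dvd ht 2) (pow_dvd_pow_of_dvd hs 2)
    rw [hυ, hτ] at this
    convert this using 1
    ring))
  have of_sq : ∀ {f g : ℚ[X]}, f ^ 2 = g → π ∣ g → π ∣ f := fun h h' =>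
    hπ.dvd_of_dvd_pow (h ▸ h')
  have hα : π ∣ rootα → (π ∣ σ ↔ π ∣ τ) := fun h => by
    constructor <;> intro h'
    · exact of_sq hτ (dvd_sub (dvd_pow h' two_ne_zero) (dvd_mul_of_dvd_left h _))
    · refine of_sq (g := τ ^ 2 + rootα * q ^ 2) (by rw [hτ]; ring) ?_
      exact dvd_add (dvd_pow h' two_ne_zero) (dvd_mul_of_dvd_left h _)
  have hβ : π ∣ rootβ → (π ∣ σ ↔ π ∣ υ) := fun h => by
    constructor <;> intro h'
    · exact of_sq hυ (dvd_sub (dvd_pow h' two_ne_zero) (dvd_mul_of_dvd_left h _))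
    · refine of_sq (g := υ ^ 2 + rootβ * q ^ 2) (by rw [hυ]; ring) ?_
      exact dvd_add (dvd_pow h' two_ne_zero) (dvd_mul_of_dvd_left h _)
  have hγ : π ∣ rootα - rootβ → (π ∣ τ ↔ π ∣ υ) := fun h => by
    constructor <;> intro h'
    · refine of_sq (g := τ ^ 2 + (rootα - rootβ) * q ^ 2) (by rw [hτ, hυ]; ring) ?_
      exact dvd_add (dvd_pow h' two_ne_zero) (dvd_mul_of_dvd_left h _)
    · refine of_sq (g := υ ^ 2 - (rootα - rootβ) * q ^ 2) (by rw [hτ, hυ]; ring) ?_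
      exact dvd_sub (dvd_pow h' two_ne_zero) (dvd_mul_of_dvd_left h _)
  suffices h : π ∣ σ ∧ π ∣ τ from ⟨h1 h.1 h.2, h.1, hq⟩
  rcases hπ.dvd_or_dvd hD with hD | hD
  · rcases hπ.dvd_or_dvd hD with hD | hD
    · rcases hπ.dvd_or_dvd hD with hσ | hτ'
      · have : π ∣ rootα * rootβ := hq2 (k := 4) (by
          have := dvd_sub (dvd_pow hσ four_ne_zero) hN
          rwa [sub_sub_cancel] at this)
        rcases hπ.dvd_or_dvd this with h | h
        · exact ⟨hσ, (hα h).1 hσ⟩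
        · exact absurd ((hβ h).1 hσ) (h2 hσ)
      · have : π ∣ rootα * (rootα - rootβ) := hq2 (k := 4) (by
          have := dvd_sub hN (dvd_mul_of_dvd_right (dvd_pow hτ' two_ne_zero)
            (σ ^ 2 + rootα * q ^ 2))
          rw [hτ] at this
          convert this using 1
          ring)
        rcases hπ.dvd_or_dvd this with h | h
        · exact ⟨(hα h).2 hτ', hτ'⟩
        · exact absurd ((hγ h).1 hτ') (h3 hτ')
    · have : π ∣ rootβ * (rootα - rootβ) := hq2 (k := 4) (by
        have := dvd_sub (dvd_mul_of_dvd_right (dvd_pow hD two_ne_zero)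
          (σ ^ 2 + rootβ * q ^ 2)) hN
        rw [hυ] at this
        convert this using 1
        ring)
      rcases hπ.dvd_or_dvd this with h | h
      · exact absurd hD (h2 ((hβ h).2 hD))
      · exact absurd hD (h3 ((hγ h).2 hD))
  · exact absurd hD hq

theorem eval_zero_ne_zero_of_not_dvd {f : ℚ[X]} (h : ¬ X ∣ f) : f.eval 0 ≠ 0 := by
  rwa [X_dvd_iff, coeff_zero_eq_eval_zero] at h

/-- In the situation of `prime_dvd_double`, the reduced denominator of the doubling formula is
divisible by `σ τ υ q` up to a factor `X ^ 2`. -/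
theorem dvd_X_sq_mul_of_double {σ τ υ q p' q' : ℚ[X]} (hτ : τ ^ 2 = σ ^ 2 - rootα * q ^ 2)
    (hυ : υ ^ 2 = σ ^ 2 - rootβ * q ^ 2) (hcop : IsCoprime σ q) (hD0 : σ * τ * υ * q ≠ 0)
    (h : 4 * (σ * τ * υ * q) ^ 2 * p' = (σ ^ 4 - rootα * rootβ * q ^ 4) ^ 2 * q' ^ 2) :
    σ * τ * υ * q ∣ X ^ 2 * q' := by
  by_cases hex : X ∣ σ ∧ ¬ X ∣ q
  · obtain ⟨⟨σ', rfl⟩, hq⟩ := hex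
    set N := X ^ 2 * σ' ^ 4 - 243 * (16 + 9 * X) * (20 + 3 * X) * rootβ * q ^ 4 with hN
    have hN' : (X * σ') ^ 4 - rootα * rootβ * q ^ 4 = X ^ 2 * N := by
      rw [hN, rootα]; ring
    have hX : ¬ X ∣ N := by
      rw [X_dvd_iff, coeff_zero_eq_eval_zero, hN]
      simp [rootβ, eval_zero_ne_zero_of_not_dvd hq]
    have hc : IsCoprime N (X * σ' * τ * υ * q) := by
      refine isCoprime_of_prime_dvd (fun h => hD0 h.2) fun π hπ h1 h2 => hX ?_
      obtain ⟨h3, -, -⟩ := prime_dvd_double hτ hυ hcop hπ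
        (by rw [hN']; exact dvd_mul_of_dvd_right h1 _) h2
      exact (hπ.associated_of_dvd prime_X h3).symm.dvd.trans h1
    rw [hN'] at h
    rw [← IsIntegrallyClosed.pow_dvd_pow_iff two_ne_zero]
    refine (hc.symm.pow (m := 2) (n := 2)).dvd_of_dvd_mul_left ⟨4 * p', ?_⟩
    linear_combination -h
  · have hc : IsCoprime (σ ^ 4 - rootα * rootβ * q ^ 4) (σ * τ * υ * q) := by
      refine isCoprime_of_prime_dvd (fun h => hD0 h.2) fun π hπ h1 h2 => hex ?_
      obtain ⟨h3, h4, h5⟩ := prime_dvd_double hτ hυ hcop hπ h1 h2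
      have := hπ.associated_of_dvd prime_X h3
      exact ⟨this.symm.dvd.trans h4, fun h => h5 (this.dvd.trans h)⟩
    refine dvd_mul_of_dvd_right ?_ _
    rw [← IsIntegrallyClosed.pow_dvd_pow_iff two_ne_zero]
    refine (hc.symm.pow (m := 2) (n := 2)).dvd_of_dvd_mul_left ⟨4 * p', ?_⟩
    linear_combination -h

theorem two_mul_max_natDegree_ge {f g r s : ℚ[X]} (hr : r ≠ 0) (hs : s ≠ 0)
    (h : f ^ 2 - g ^ 2 = r * s ^ 2) : r.natDegree ≤ 2 * max f.natDegree g.natDegree := by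
  have h1 := natDegree_sub_le (f ^ 2) (g ^ 2)
  rw [h, natDegree_mul hr (pow_ne_zero 2 hs), natDegree_pow, natDegree_pow, natDegree_pow] at h1
  omega

theorem natDegree_rootα : rootα.natDegree = 4 := by
  rw [rootα]
  compute_degree!

theorem natDegree_rootβ : rootβ.natDegree = 4 := by
  rw [rootβ]
  compute_degree!

theorem natDegree_rootα_sub_rootβ : (rootα - rootβ).natDegree = 2 := by
  rw [rootα_sub_rootβ]
  compute_degree!

theorem num_mul_sq {x : Qa} {q : ℚ[X]} (hd : x.denom = q ^ 2) : x * ι q ^ 2 = ι x.num := by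
  have hx : x = ι x.num / ι x.denom := (RatFunc.num_div_denom x).symm
  rw [← map_pow, ← hd]
  nth_rw 1 [hx]
  exact div_mul_cancel₀ _ (ι_ne_zero (RatFunc.denom_ne_zero x))

theorem exists_sq_of_isSquare {x : Qa} {q r : ℚ[X]} (hd : x.denom = q ^ 2)
    (h : IsSquare (x - ι r)) : ∃ s : ℚ[X], s ^ 2 = x.num - r * q ^ 2 := by
  obtain ⟨s, hs⟩ : IsSquare (x.num - r * q ^ 2) := by
    apply isSquare_of_ι
    have : ι (x.num - r * q ^ 2) = (x - ι r) * ι q ^ 2 := by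
      rw [sub_mul, num_mul_sq hd]
      simp
    rw [this]
    exact h.mul ⟨ι q, sq _⟩
  exact ⟨s, by rw [hs, sq]⟩

/-- Doubling a point of `2 E` increases the degree of the denominator of the `x`-coordinate. By
`dvd_X_sq_mul_of_double` the new denominator is at least `(σ τ υ q / X ^ 2) ^ 2`, and the degrees of
the differences `α`, `β` and `α - β` of the roots force `σ τ υ` to have degree at least three. -/
theorem natDegree_denom_lt [DecidableEq Qa] {Q : E.toAffine.Point} {x y x' y' : Qa}
    {h : E.toAffine.Nonsingular x y} {h' : E.toAffine.Nonsingular x' y'}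
    (hQ : Q + Q = .some x y h) (hP : Point.some x y h + .some x y h = .some x' y' h') :
    x.denom.natDegree < x'.denom.natDegree := by
  obtain ⟨q, n, hqm, hd, hcop, hy, hn⟩ := exists_lowest_terms h
  obtain ⟨q', n', hqm', hd', hcop', hy', hn'⟩ := exists_lowest_terms h'
  obtain ⟨σ, hσ⟩ := exists_sq_of_isSquare (r := 0) hd
    (by simpa using isSquare_of_double E₀ ια_ne.symm ιβ_ne.symm hQ)
  obtain ⟨τ, hτ⟩ := exists_sq_of_isSquare hd
    (isSquare_of_double Eα ια_ne ια_ne_ιβ hQ)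
  obtain ⟨υ, hυ⟩ := exists_sq_of_isSquare hd
    (isSquare_of_double Eβ ιβ_ne ια_ne_ιβ.symm hQ)
  rw [zero_mul, sub_zero] at hσ
  have hxq := num_mul_sq hd
  have hxq' := num_mul_sq hd'
  rw [← hσ] at hcop hn hτ hυ hxq
  obtain ⟨hy0, hdbl⟩ := E₀.double two_ne hP
  have hE := (E₀.equation_iff _ _).1 h.1
  have hιq := ι_ne_zero hqm.ne_zero
  have hιq' := ι_ne_zero hqm'.ne_zero
  have hn0 : n ≠ 0 := by
    rintro rfl
    simp [hy] at hy0
  have hD0 : σ * τ * υ * q ≠ 0 := by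
    refine mul_ne_zero ?_ hqm.ne_zero
    intro h0
    have : n ^ 2 = (σ * τ * υ) ^ 2 := by rw [hn, ← hτ, ← hυ]; ring
    rw [h0] at this
    exact hn0 (by simpa using this)
  have hcop2 : IsCoprime σ q := (IsCoprime.pow_left_iff two_pos).1 hcop
  have key : 4 * (σ * τ * υ * q) ^ 2 * x'.num =
      (σ ^ 4 - rootα * rootβ * q ^ 4) ^ 2 * q' ^ 2 := by
    apply ι_injective
    have e1 : (ι n) ^ 2 = (ι σ * ι τ * ι υ) ^ 2 := by
      simp only [← map_mul, ← map_pow]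
      rw [hn, ← hτ, ← hυ]
      ring_nf
    have e2 : y * ι q ^ 3 = ι n := by rw [hy, div_mul_cancel₀ _ (pow_ne_zero 3 hιq)]
    have e3 : (y * ι q ^ 3) ^ 2 = (ι σ * ι τ * ι υ) ^ 2 := by rw [e2, e1]
    have e4 : (x * ι q ^ 2) ^ 2 = ι σ ^ 4 := by rw [hxq, map_pow]; ring
    have e5 : (x * ι q ^ 2) ^ 4 = ι σ ^ 8 := by rw [hxq, map_pow]; ring
    simp only [map_mul, map_pow, map_sub, map_ofNat]
    rw [← hxq']
    linear_combination -4 * ι q ^ 2 * x' * ι q' ^ 2 * e3 + ι q ^ 8 * ι q' ^ 2 * hdbl +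
      ι q' ^ 2 * e5 - 2 * ι q' ^ 2 * ι rootα * ι rootβ * ι q ^ 4 * e4
  have hdvd := dvd_X_sq_mul_of_double hτ hυ hcop2 hD0 key
  have hdeg := natDegree_le_of_dvd hdvd (mul_ne_zero (pow_ne_zero 2 X_ne_zero) hqm'.ne_zero)
  have hσ0 : σ ≠ 0 := by rintro rfl; simp at hD0
  have hτ0 : τ ≠ 0 := by rintro rfl; simp at hD0
  have hυ0 : υ ≠ 0 := by rintro rfl; simp at hD0
  rw [natDegree_mul (mul_ne_zero (mul_ne_zero hσ0 hτ0) hυ0) hqm.ne_zero,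
    natDegree_mul (mul_ne_zero hσ0 hτ0) hυ0, natDegree_mul hσ0 hτ0,
    natDegree_mul (pow_ne_zero 2 X_ne_zero) hqm'.ne_zero, natDegree_X_pow] at hdeg
  have h1 := two_mul_max_natDegree_ge rootα_ne_zero hqm.ne_zero (f := σ) (g := τ)
    (by rw [hτ]; ring)
  have h2 := two_mul_max_natDegree_ge rootβ_ne_zero hqm.ne_zero (f := σ) (g := υ)
    (by rw [hυ]; ring)
  have h3 := two_mul_max_natDegree_ge (sub_ne_zero.2 rootα_ne_rootβ) hqm.ne_zero (f := υ) (g := τ)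
    (by rw [hτ, hυ]; ring)
  rw [natDegree_rootα] at h1
  rw [natDegree_rootβ] at h2
  rw [natDegree_rootα_sub_rootβ] at h3
  rw [hd, hd', natDegree_pow, natDegree_pow]
  omega

end

/-! ### The torsion subgroup -/

section

open Polynomial WeierstrassCurve.Affine

/-- The point of order two with `x = β`. -/
def T₃ : E.toAffine.Point := point rootβ 0 (by ring)

theorem y_eq_zero {x y : Qa} (h : E.toAffine.Nonsingular x y)
    (hx : x * (x - ι rootα) * (x - ι rootβ) = 0) : y = 0 := by
  have := (E₀.equation_iff _ _).1 h.1
  rw [sub_zero, hx] at this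
  exact pow_eq_zero_iff two_ne_zero |>.1 this

theorem eq_T_of_X {x y : Qa} (h : E.toAffine.Nonsingular x y)
    (hx : x * (x - ι rootα) * (x - ι rootβ) = 0) :
    Point.some x y h = T₁ ∨ Point.some x y h = T₂ ∨ Point.some x y h = T₃ := by
  have hy := y_eq_zero h hx
  simp only [T₁, T₂, T₃, point, Point.some.injEq, map_zero, hy, and_true]
  rcases mul_eq_zero.1 hx with h1 | h1
  · rcases mul_eq_zero.1 h1 with h1 | h1
    · exact Or.inl h1
    · exact Or.inr (Or.inl (sub_eq_zero.1 h1))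
  · exact Or.inr (Or.inr (sub_eq_zero.1 h1))

theorem T₁_ne_T₂ : T₁ ≠ T₂ := by
  simpa [T₁, T₂, point] using ια_ne.symm

theorem T₁_ne_T₃ : T₁ ≠ T₃ := by
  simpa [T₁, T₃, point] using ιβ_ne.symm

theorem T₂_ne_T₃ : T₂ ≠ T₃ := by
  simpa [T₂, T₃, point] using ια_ne_ιβ

theorem T_ne_zero : T₁ ≠ 0 ∧ T₂ ≠ 0 ∧ T₃ ≠ 0 :=
  ⟨Point.some_ne_zero _, Point.some_ne_zero _, Point.some_ne_zero _⟩

variable [DecidableEq Qa]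

theorem add_self_eq_zero_iff (P : E.toAffine.Point) :
    P + P = 0 ↔ P = 0 ∨ P = T₁ ∨ P = T₂ ∨ P = T₃ := by
  rcases P with _ | ⟨x, y, h⟩
  · simp [← Point.zero_def]
  have hneg : Point.some x y h + .some x y h = 0 ↔ y = 0 := by
    rw [add_eq_zero_iff_eq_neg, Point.neg_some, Point.some.injEq, E₀.negY]
    constructor
    · rintro ⟨-, h1⟩
      exact (mul_eq_zero.1 (by linear_combination h1 : (2 : Qa) * y = 0)).resolve_left two_ne
    · rintro rfl
      simp
  rw [hneg]
  constructor
  · rintro rfl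
    have := (E₀.equation_iff _ _).1 h.1
    rw [sub_zero] at this
    exact Or.inr (eq_T_of_X h (by rw [← this]; ring))
  · simp only [T₁, T₂, T₃, point, Point.some.injEq, map_zero]
    rintro (h | h | h | h)
    · exact absurd h (Point.some_ne_zero _)
    all_goals exact h.2

theorem T₁_add_T₂ : T₁ + T₂ = T₃ := by
  have h1 : T₁ + T₁ = 0 := (add_self_eq_zero_iff _).2 (by simp)
  have h2 : T₂ + T₂ = 0 := (add_self_eq_zero_iff _).2 (by simp)
  have h : T₁ + T₂ + (T₁ + T₂) = 0 := by
    rw [add_add_add_comm, h1, h2, add_zero]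
  rcases (add_self_eq_zero_iff _).1 h with h | h | h | h
  · exact absurd (add_right_cancel (h.trans h2.symm)) T₁_ne_T₂
  · exact absurd (by simpa using h) T_ne_zero.2.1
  · exact absurd (by simpa using h) T_ne_zero.1
  · exact h

theorem orderChar_T₁ (k : Fin 6) : orderChar k T₁ = orderMatrix k 4 := orderChar_gen k 4

theorem orderChar_T₂ (k : Fin 6) : orderChar k T₂ = orderMatrix k 5 := orderChar_gen k 5

/-- The characters `orderChar` detect the points of order two. -/
theorem exists_orderChar_ne_zero {P : E.toAffine.Point} (h : P + P = 0) (h0 : P ≠ 0) :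
    ∃ k, orderChar k P ≠ 0 := by
  rcases (add_self_eq_zero_iff _).1 h with rfl | rfl | rfl | rfl
  · exact absurd rfl h0
  · exact ⟨1, by rw [orderChar_T₁]; decide⟩
  · exact ⟨1, by rw [orderChar_T₂]; decide⟩
  · exact ⟨3, by rw [← T₁_add_T₂, map_add, orderChar_T₁, orderChar_T₂]; decide⟩

/-- The degree of the denominator of the `x`-coordinate. -/
def denomDegree : E.toAffine.Point → ℕ
  | .zero => 0
  | .some x _ _ => x.denom.natDegree

theorem denomDegree_lt {Q D : E.toAffine.Point} (hQ : Q + Q = D) (hD : D ≠ 0) :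
    D + D ≠ 0 ∧ denomDegree D < denomDegree (D + D) := by
  have hDD : D + D ≠ 0 := fun h => by
    obtain ⟨k, hk⟩ := exists_orderChar_ne_zero h hD
    rw [← hQ, map_add, CharTwo.add_self_eq_zero] at hk
    exact hk rfl
  refine ⟨hDD, ?_⟩
  rcases D with _ | ⟨x, y, h⟩
  · exact absurd rfl hD
  rcases hP : Point.some x y h + .some x y h with _ | ⟨x', y', h'⟩
  · exact absurd hP hDD
  rw [hP]
  exact natDegree_denom_lt hQ hP

/-- The torsion points are the points of order dividing two: the multiples by powers of two of a
non-zero point of `2 E` have denominators of increasing degrees. -/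
theorem add_self_eq_zero_of_isOfFinAddOrder {P : E.toAffine.Point} (hP : IsOfFinAddOrder P) :
    P + P = 0 := by
  by_contra h0
  have key : ∀ k : ℕ, 2 ^ (k + 1) • P ≠ 0 ∧
      denomDegree (2 ^ (k + 1) • P) < denomDegree (2 ^ (k + 2) • P) := by
    intro k
    induction k with
    | zero =>
      have := denomDegree_lt (Q := P) rfl h0
      rw [← two_nsmul, ← two_nsmul, smul_smul] at this
      exact ⟨by simpa [two_nsmul] using h0, by simpa using this.2⟩
    | succ k ih =>
      have e : ∀ k : ℕ, 2 ^ k • P + 2 ^ k • P = 2 ^ (k + 1) • P := fun k => by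
        rw [← two_nsmul, smul_smul, pow_succ']
      have h1 : 2 ^ (k + 2) • P ≠ 0 := fun h => by
        rw [h] at ih
        exact absurd ih.2 (Nat.not_lt_zero _)
      have := denomDegree_lt (e (k + 1)) h1
      rw [e] at this
      exact ⟨h1, this.2⟩
  have hmono : StrictMono fun k : ℕ => denomDegree (2 ^ (k + 1) • P) :=
    strictMono_nat_of_lt_succ fun k => (key k).2
  have hfin : (AddSubmonoid.multiples P : Set E.toAffine.Point).Finite := finite_multiples.2 hP
  have hinj : Function.Injective fun k : ℕ => 2 ^ (k + 1) • P := fun i j h =>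
    hmono.injective (congrArg denomDegree h)
  exact Set.infinite_range_of_injective hinj (hfin.subset (by
    rintro _ ⟨k, rfl⟩
    exact ⟨_, rfl⟩))

theorem mem_torsion_iff (P : E.toAffine.Point) :
    P ∈ AddCommGroup.torsion E.toAffine.Point ↔ P = 0 ∨ P = T₁ ∨ P = T₂ ∨ P = T₃ := by
  rw [← add_self_eq_zero_iff]
  refine ⟨fun h => add_self_eq_zero_of_isOfFinAddOrder h, fun h => ?_⟩
  exact isOfFinAddOrder_iff_nsmul_eq_zero.2 ⟨2, two_pos, by rw [two_nsmul, h]⟩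

theorem isAddKleinFour_torsion : IsAddKleinFour (AddCommGroup.torsion E.toAffine.Point) := by
  have hset : ((AddCommGroup.torsion E.toAffine.Point : AddSubgroup _) : Set E.toAffine.Point) =
      {0, T₁, T₂, T₃} := by
    ext P
    simp [mem_torsion_iff]
  have hcard : Nat.card (AddCommGroup.torsion E.toAffine.Point) = 4 := by
    change Nat.card ((AddCommGroup.torsion E.toAffine.Point : AddSubgroup _) :
      Set E.toAffine.Point) = 4
    rw [hset, Nat.card_coe_set_eq, Set.ncard_eq_toFinset_card']
    classical
    rw [Set.toFinset_insert, Set.toFinset_insert, Set.toFinset_insert, Set.toFinset_singleton,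
      Finset.card_insert_of_notMem, Finset.card_insert_of_notMem, Finset.card_insert_of_notMem,
      Finset.card_singleton]
    · simpa using T₂_ne_T₃
    · simpa using ⟨T₁_ne_T₂, T₁_ne_T₃⟩
    · simpa using ⟨T_ne_zero.1.symm, T_ne_zero.2.1.symm, T_ne_zero.2.2.symm⟩
  refine ⟨hcard, ?_⟩
  have hdvd : AddMonoid.exponent (AddCommGroup.torsion E.toAffine.Point) ∣ 2 :=
    AddMonoid.exponent_dvd_of_forall_nsmul_eq_zero fun P => by
      rw [two_nsmul]
      exact Subtype.ext (add_self_eq_zero_of_isOfFinAddOrder P.2)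
  refine ((Nat.dvd_prime Nat.prime_two).1 hdvd).resolve_left fun h => ?_
  have := AddMonoid.exp_eq_one_iff.1 h
  rw [Nat.card_of_subsingleton 0] at hcard
  norm_num at hcard

end

/-! ### The upper bound for `E / 2 E` -/

section

open Polynomial WeierstrassCurve.Affine

theorem exists_squarefree_mul_sq (f : ℚ[X]) (hf : f ≠ 0) :
    ∃ b s : ℚ[X], Squarefree b ∧ s ≠ 0 ∧ f = b * s ^ 2 := by
  induction hd : f.natDegree using Nat.strong_induction_on generalizing f with
  | _ d ih =>
    by_cases h : Squarefree f
    · exact ⟨f, 1, h, one_ne_zero, by ring⟩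
    rw [Squarefree] at h
    push Not at h
    obtain ⟨g, ⟨r, rfl⟩, hg⟩ := h
    obtain ⟨⟨hg0, -⟩, hr0⟩ : (g ≠ 0 ∧ g ≠ 0) ∧ r ≠ 0 := by simpa [not_or] using hf
    have hgd : 0 < g.natDegree := by
      refine Nat.pos_of_ne_zero fun h0 => hg ?_
      rw [eq_C_of_natDegree_eq_zero h0] at hg0 ⊢
      exact isUnit_C.2 (isUnit_iff_ne_zero.2 fun h => hg0 (by rw [h, C_0]))
    rw [natDegree_mul (mul_ne_zero hg0 hg0) hr0, natDegree_mul hg0 hg0] at hd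
    obtain ⟨b, s, hb, hs, h⟩ := ih r.natDegree (by omega) r hr0 rfl
    exact ⟨b, s * g, hb, mul_ne_zero hs hg0, by rw [h]; ring⟩

/-- If `f` has even order at `t`, then its squarefree part does not vanish there. -/
theorem eval_ne_zero_of_order {b f s : ℚ[X]} {t : ℚ} (hb : Squarefree b) (hs : s ≠ 0)
    (hf : f = b * s ^ 2) (h : ParityChar.order t f = 0) : b.eval t ≠ 0 := by
  intro h0
  have h1 : b.derivative.eval t ≠ 0 := by
    have := (PerfectField.separable_iff_squarefree.2 hb).eval₂_derivative_ne_zero (RingHom.id ℚ)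
      (x := t) (by rwa [eval₂_id])
    rwa [eval₂_id] at this
  rw [hf, ParityChar.map_mul _ hb.ne_zero (pow_ne_zero 2 hs), ParityChar.map_sq _ hs,
    ParityChar.order_of_simple h0 h1] at h
  exact absurd h (by decide)

theorem eval_eq_zero_of_prime_dvd {π b : ℚ[X]} {u v : ℚ} (t : ℚ) (hπ : Prime π) (hb : π ∣ b)
    (h : π ∣ C u + C v * X) (hv : v ≠ 0) (ht : u + v * t = 0) : b.eval t = 0 := by
  have h1 : (C u + C v * X : ℚ[X]) = C v * (X - C t) := by
    rw [mul_sub, ← C_mul, eq_neg_of_add_eq_zero_right ht, C_neg]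
    ring
  rw [h1] at h
  rcases hπ.dvd_or_dvd h with h | h
  · exact absurd (isUnit_of_dvd_unit h (isUnit_C.2 hv.isUnit)) hπ.not_isUnit
  · exact dvd_iff_isRoot.1 (((hπ.associated_of_dvd (prime_X_sub_C t) h).symm.dvd).trans hb)

theorem exists_eq_C_of_forall_prime {b : ℚ[X]} (hb : b ≠ 0) (h : ∀ π, Prime π → ¬ π ∣ b) :
    ∃ c : ℚ, c ≠ 0 ∧ b = C c := by
  have hu : IsUnit b := by
    by_contra hu
    obtain ⟨π, hπ, hd⟩ := WfDvdMonoid.exists_irreducible_factor hu hb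
    exact h π hπ.prime hd
  obtain ⟨c, hc, rfl⟩ := Polynomial.isUnit_iff.1 hu
  exact ⟨c, hc.ne_zero, rfl⟩

theorem exists_sq_eq_of_sq_eq {n b s r : ℚ[X]} (hs : s ≠ 0) (h : n ^ 2 = b * s ^ 2 * r) :
    ∃ m, m ^ 2 = b * r := by
  have : s ∣ n := by
    rw [← IsIntegrallyClosed.pow_dvd_pow_iff two_ne_zero, h]
    exact ⟨b * r, by ring⟩
  obtain ⟨m, rfl⟩ := this
  exact ⟨m, mul_left_cancel₀ (pow_ne_zero 2 hs) (by linear_combination h)⟩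

/-- If `b r` is a square, then the prime factors of a squarefree `b` divide the cofactor `r`. -/
theorem prime_dvd_of_sq_eq {m b r π : ℚ[X]} (hb : Squarefree b) (hπ : Prime π) (hd : π ∣ b)
    (h : m ^ 2 = b * r) : π ∣ r := by
  obtain ⟨m', rfl⟩ := hπ.dvd_of_dvd_pow (h ▸ dvd_mul_of_dvd_left hd r)
  obtain ⟨b', rfl⟩ := hd
  have h1 : π * m' ^ 2 = b' * r := mul_left_cancel₀ hπ.ne_zero (by linear_combination h)
  rcases hπ.dvd_or_dvd (h1 ▸ dvd_mul_right π _) with h2 | h2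
  · exact absurd (hb π (mul_dvd_mul_left π h2)) hπ.not_isUnit
  · exact h2

theorem exists_eq_pow_mul {b π : ℚ[X]} (hb : Squarefree b) (hπ : Prime π) :
    ∃ (i : Fin 2) (b' : ℚ[X]), b = π ^ (i : ℕ) * b' ∧ ¬ π ∣ b' := by
  by_cases h : π ∣ b
  · obtain ⟨b', rfl⟩ := h
    exact ⟨1, b', by simp, fun h => hπ.not_isUnit (hb π (mul_dvd_mul_left π h))⟩
  · exact ⟨0, b, by simp, h⟩

theorem prime_linear {u v : ℚ} (hv : v ≠ 0) : Prime (C u + C v * X) := by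
  rw [add_comm, mul_comm]
  have := irreducible_of_degree_eq_one (p := X * C v + C u) (by compute_degree!)
  exact this.prime

theorem prime_quadratic : Prime (320 + 81 * X ^ 2 : ℚ[X]) := by
  have h2 : (320 + 81 * X ^ 2 : ℚ[X]).natDegree = 2 := by compute_degree!
  apply Irreducible.prime
  rw [irreducible_iff_roots_eq_zero_of_degree_le_three (by omega) (by omega)]
  rw [Multiset.eq_zero_iff_forall_notMem]
  intro t ht
  have := (mem_roots'.1 ht).2
  simp [IsRoot] at this
  nlinarith [sq_nonneg t]

theorem not_isSquare_of_padicValRat {p : ℕ} [Fact p.Prime] {x : ℚ}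
    (h : ((padicValRat p x : ℤ) : ZMod 2) ≠ 0) : ¬ IsSquare x :=
  fun hs => h (ParityChar.cast_padicValRat_eq_zero hs)

section

variable {p q f g : ℚ[X]} (hf : f = p - rootα * q ^ 2) (hg : g = p - rootβ * q ^ 2)
  (hcop : IsCoprime p q)

include hf hg hcop in
/-- A common prime factor of `x - α` and `x (x - β)` divides `α (α - β)`. -/
theorem prime_dvd_of_dvd_f {π : ℚ[X]} (hπ : Prime π) (h : π ∣ f) (h' : π ∣ p * g) :
    π ∣ X ∨ π ∣ 16 + 9 * X ∨ π ∣ 20 + 3 * X ∨ π ∣ -20 + 9 * X ∨ π ∣ -16 + 27 * X := by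
  have hq : ¬ π ∣ q := fun hq => hπ.not_isUnit (hcop.isUnit_of_dvd' (by
    have := dvd_add h (dvd_mul_of_dvd_right (dvd_pow hq two_ne_zero) rootα)
    rwa [hf, sub_add_cancel] at this) hq)
  have hq2 : ∀ {r}, π ∣ r * q ^ 2 → π ∣ r := fun {r} h =>
    (hπ.dvd_or_dvd h).resolve_right fun h => hq (hπ.dvd_of_dvd_pow h)
  have hunit : ∀ {c : ℚ}, c ≠ 0 → ¬ π ∣ C c := fun {c} hc h =>
    hπ.not_isUnit (isUnit_of_dvd_unit h (isUnit_C.2 hc.isUnit))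
  have h1 : π ∣ rootα ∨ π ∣ rootα - rootβ := by
    rcases hπ.dvd_or_dvd h' with h' | h'
    · left
      apply hq2
      have := dvd_sub h' h
      rwa [hf, sub_sub_cancel] at this
    · right
      apply hq2
      have := dvd_sub h' h
      rw [hf, hg] at this
      convert this using 1
      ring
  rcases h1 with h1 | h1
  · rw [rootα] at h1
    rcases hπ.dvd_or_dvd h1 with h1 | h1
    · rcases hπ.dvd_or_dvd h1 with h1 | h1
      · rcases hπ.dvd_or_dvd h1 with h1 | h1
        · exact absurd h1 (hunit (c := 243) (by norm_num))
        · exact Or.inl (hπ.dvd_of_dvd_pow h1)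
      · exact Or.inr (Or.inl h1)
    · exact Or.inr (Or.inr (Or.inl h1))
  · rw [rootα_sub_rootβ] at h1
    rcases hπ.dvd_or_dvd h1 with h1 | h1
    · rcases hπ.dvd_or_dvd h1 with h1 | h1
      · exact absurd h1 (hunit (c := 320) (by norm_num))
      · exact Or.inr (Or.inr (Or.inr (Or.inl h1)))
    · exact Or.inr (Or.inr (Or.inr (Or.inr h1)))

include hf hg hcop in
/-- If `x - α` has even order at the zeros of `α (α - β)`, then it is a square up to a constant. -/
theorem exists_eq_C_mul_sq {n : ℚ[X]} (hf0 : f ≠ 0) (hn : n ^ 2 = f * (p * g))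
    (h₀ : ParityChar.order 0 f = 0) (h₁ : ParityChar.order (-16 / 9) f = 0)
    (h₂ : ParityChar.order (-20 / 3) f = 0) (h₃ : ParityChar.order (20 / 9) f = 0)
    (h₄ : ParityChar.order (16 / 27) f = 0) :
    ∃ (c : ℚ) (s : ℚ[X]), c ≠ 0 ∧ s ≠ 0 ∧ f = C c * s ^ 2 := by
  obtain ⟨b, s, hb, hs, hbs⟩ := exists_squarefree_mul_sq f hf0
  obtain ⟨m, hm⟩ := exists_sq_eq_of_sq_eq (b := b) hs (by rw [hn, ← hbs])
  obtain ⟨c, hc, rfl⟩ := exists_eq_C_of_forall_prime hb.ne_zero fun π hπ hd => by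
    have h1 := prime_dvd_of_sq_eq hb hπ hd hm
    have h2 : π ∣ f := hbs ▸ dvd_mul_of_dvd_left hd _
    rcases prime_dvd_of_dvd_f hf hg hcop hπ h2 h1 with h | h | h | h | h
    · exact eval_ne_zero_of_order hb hs hbs h₀
        (eval_eq_zero_of_prime_dvd (u := 0) (v := 1) 0 hπ hd (by simpa using h) one_ne_zero
          (by norm_num))
    · exact eval_ne_zero_of_order hb hs hbs h₁
        (eval_eq_zero_of_prime_dvd (u := 16) (v := 9) _ hπ hd h (by norm_num) (by norm_num))
    · exact eval_ne_zero_of_order hb hs hbs h₂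
        (eval_eq_zero_of_prime_dvd (u := 20) (v := 3) _ hπ hd h (by norm_num) (by norm_num))
    · exact eval_ne_zero_of_order hb hs hbs h₃
        (eval_eq_zero_of_prime_dvd (u := -20) (v := 9) _ hπ hd (by rwa [C_neg]) (by norm_num)
          (by norm_num))
    · exact eval_ne_zero_of_order hb hs hbs h₄
        (eval_eq_zero_of_prime_dvd (u := -16) (v := 27) _ hπ hd (by rwa [C_neg]) (by norm_num)
          (by norm_num))
  exact ⟨c, s, hc, hs, hbs⟩

include hg hcop in
/-- If moreover `x` has even order at `4 / 9`, then the squarefree part of its numerator divides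
`(80 + 9 X) (320 + 81 X ^ 2)` up to a constant. -/
theorem exists_eq_mul_sq {m : ℚ[X]} {c₂ : ℚ} (hc₂ : c₂ ≠ 0) (hp0 : p ≠ 0)
    (hm : m ^ 2 = p * (C c₂ * g)) (h₅ : ParityChar.order (4 / 9) p = 0) :
    ∃ (i j : Fin 2) (c : ℚ) (s : ℚ[X]), c ≠ 0 ∧ s ≠ 0 ∧
      p = C c * (80 + 9 * X) ^ (i : ℕ) * (320 + 81 * X ^ 2) ^ (j : ℕ) * s ^ 2 := by
  obtain ⟨b, s, hb, hs, hbs⟩ := exists_squarefree_mul_sq p hp0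
  obtain ⟨m', hm'⟩ := exists_sq_eq_of_sq_eq (b := b) hs (by rw [hm, ← hbs])
  have hL : Prime (80 + 9 * X : ℚ[X]) := prime_linear (u := 80) (v := 9) (by norm_num)
  obtain ⟨i, b₁, hb₁, hd₁⟩ := exists_eq_pow_mul hb hL
  have hsq₁ : Squarefree b₁ := hb.squarefree_of_dvd (hb₁ ▸ dvd_mul_left _ _)
  obtain ⟨j, b₂, hb₂, hd₂⟩ := exists_eq_pow_mul hsq₁ prime_quadratic
  have hdvd₂ : b₂ ∣ b₁ := hb₂ ▸ dvd_mul_left _ _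
  have hdvd : b₂ ∣ b := hdvd₂.trans (hb₁ ▸ dvd_mul_left _ _)
  obtain ⟨c, hc, rfl⟩ := exists_eq_C_of_forall_prime (b := b₂)
    (fun h => hb.ne_zero (by rw [hb₁, hb₂, h]; simp)) fun π hπ hd => by
    have hdb := hd.trans hdvd
    have hp : π ∣ p := hbs ▸ dvd_mul_of_dvd_left hdb _
    have hg' : π ∣ g := by
      refine (hπ.dvd_or_dvd (prime_dvd_of_sq_eq hb hπ hdb hm')).resolve_left fun h => ?_
      exact hπ.not_isUnit (isUnit_of_dvd_unit h (isUnit_C.2 hc₂.isUnit))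
    have hβ : π ∣ rootβ := by
      have := dvd_sub hp hg'
      rw [hg, sub_sub_cancel] at this
      exact (hπ.dvd_or_dvd this).resolve_right fun h =>
        hπ.not_isUnit (hcop.isUnit_of_dvd' hp (hπ.dvd_of_dvd_pow h))
    rw [rootβ] at hβ
    rcases hπ.dvd_or_dvd hβ with h | h
    · rcases hπ.dvd_or_dvd h with h | h
      · exact hd₁ (((hπ.associated_of_dvd hL h).symm.dvd).trans (hd.trans hdvd₂))
      · exact eval_ne_zero_of_order hb hs hbs h₅
          (eval_eq_zero_of_prime_dvd (u := -4) (v := 9) _ hπ hdb (by rwa [C_neg]) (by norm_num)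
            (by norm_num))
    · exact hd₂ (((hπ.associated_of_dvd prime_quadratic h).symm.dvd).trans hd)
  refine ⟨i, j, c, s, hc, hs, ?_⟩
  rw [hbs, hb₁, hb₂]
  ring

/-- If `r q ^ 2` has a multiple zero at a simple zero of `r`, then `q` vanishes there. -/
theorem eval_eq_zero_of_simple_root {r d : ℚ[X]} {t : ℚ} (hr : r.derivative.eval t ≠ 0)
    (h : r * q ^ 2 = (X - C t) ^ 2 * d) : q.eval t = 0 := by
  by_contra hq
  have h1 := congrArg (eval t) h
  simp [hq] at h1
  have h2 := congrArg (fun z => eval t (derivative z)) h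
  simp [derivative_mul, derivative_pow, h1] at h2
  exact h2.elim hr hq

theorem eval_ne_zero_of_isCoprime {u v : ℚ[X]} (h : IsCoprime u v) {t : ℚ} (hu : u.eval t = 0) :
    v.eval t ≠ 0 := by
  obtain ⟨a, b, hab⟩ := h
  intro hv
  have := congrArg (eval t) hab
  simp [hu, hv] at this

include hf hg hcop in
/-- At a common zero `t` of `x - α` and `x - β` the class of `x` modulo squares specializes to the
trivial class. -/
theorem isSquare_eval_of_root {b m s : ℚ[X]} {c₂ t : ℚ} (hc₂ : c₂ ≠ 0) (hfs : f = C c₂ * s ^ 2)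
    (hm : m ^ 2 = b * (C c₂ * g)) (hb : b.eval t ≠ 0) (ht : (rootα - rootβ).eval t = 0)
    (ht' : (rootα - rootβ).derivative.eval t ≠ 0) : IsSquare (b.eval t) := by
  have hgf : g - f = (rootα - rootβ) * q ^ 2 := by rw [hf, hg]; ring
  have hgt : g.eval t = c₂ * s.eval t ^ 2 := by
    have h1 := congrArg (eval t) hgf
    have h2 := congrArg (eval t) hfs
    simp [ht] at h1 h2
    linear_combination h1 + h2
  have hmt : m.eval t ^ 2 = b.eval t * (c₂ * s.eval t) ^ 2 := by
    have := congrArg (eval t) hm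
    simp [hgt] at this
    linear_combination this
  by_cases hs : s.eval t = 0
  · exfalso
    rw [hs] at hmt
    obtain ⟨m', rfl⟩ := dvd_iff_isRoot.2 (show m.IsRoot t by simpa using hmt)
    obtain ⟨s', rfl⟩ := dvd_iff_isRoot.2 (show s.IsRoot t from hs)
    have hXb : IsCoprime ((X - C t) ^ 2) b := by
      refine IsCoprime.pow_left (((prime_X_sub_C t).irreducible.coprime_iff_not_dvd).2 ?_)
      rw [dvd_iff_isRoot]
      exact hb
    have hXc : IsCoprime ((X - C t) ^ 2) (C c₂) :=
      ⟨0, C c₂⁻¹, by simp [← C_mul, hc₂]⟩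
    obtain ⟨g', hg'⟩ : (X - C t) ^ 2 ∣ g := by
      refine hXc.dvd_of_dvd_mul_left (hXb.dvd_of_dvd_mul_left ⟨m' ^ 2, ?_⟩)
      rw [← hm]
      ring
    have hq : q.eval t = 0 := eval_eq_zero_of_simple_root (d := g' - C c₂ * s' ^ 2) ht' (by
      rw [← hgf, hg', hfs]
      ring)
    refine eval_ne_zero_of_isCoprime hcop ?_ hq
    have h1 := congrArg (eval t) hf
    have h2 := congrArg (eval t) hfs
    simp [hq] at h1 h2
    rw [← h1, h2]
  · refine ⟨m.eval t / (c₂ * s.eval t), ?_⟩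
    field_simp
    linear_combination -hmt

include hf hcop in
/-- At a common zero of `x` and `x - α` their classes modulo squares agree. -/
theorem isSquare_mul_of_root {z s : ℚ[X]} {c₁ c₂ t : ℚ} (hc₁ : c₁ ≠ 0)
    (hpz : p = C c₁ * z ^ 2) (hfs : f = C c₂ * s ^ 2) (ht : rootα.eval t = 0)
    (ht' : rootα.derivative.eval t ≠ 0) : IsSquare (c₁ * c₂) := by
  have hpf : p - f = rootα * q ^ 2 := by rw [hf]; ring
  have heq : c₁ * z.eval t ^ 2 = c₂ * s.eval t ^ 2 := by
    have h1 := congrArg (eval t) hpf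
    have h2 := congrArg (eval t) hfs
    have h3 := congrArg (eval t) hpz
    simp [ht] at h1 h2 h3
    linear_combination h1 + h2 - h3
  by_cases hs : s.eval t = 0
  · exfalso
    have hz : z.eval t = 0 := by simpa [hs, hc₁] using heq
    obtain ⟨z', rfl⟩ := dvd_iff_isRoot.2 (show z.IsRoot t from hz)
    obtain ⟨s', rfl⟩ := dvd_iff_isRoot.2 (show s.IsRoot t from hs)
    have hq : q.eval t = 0 :=
      eval_eq_zero_of_simple_root (d := C c₁ * z' ^ 2 - C c₂ * s' ^ 2) ht' (by
        rw [← hpf, hpz, hfs]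
        ring)
    refine eval_ne_zero_of_isCoprime hcop ?_ hq
    rw [hpz]
    simp
  · refine ⟨c₁ * z.eval t / s.eval t, ?_⟩
    field_simp
    linear_combination -heq

include hf hg hcop in
/-- The conditions on the parities of orders of vanishing force `x` and `x - α` to be squares. -/
theorem isSquare_of_order {n : ℚ[X]} (hp0 : p ≠ 0) (hf0 : f ≠ 0) (hn : n ^ 2 = p * f * g)
    (h₀ : ParityChar.order 0 f = 0) (h₁ : ParityChar.order (-16 / 9) f = 0)
    (h₂ : ParityChar.order (-20 / 3) f = 0) (h₃ : ParityChar.order (20 / 9) f = 0)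
    (h₄ : ParityChar.order (16 / 27) f = 0) (h₅ : ParityChar.order (4 / 9) p = 0) :
    IsSquare p ∧ IsSquare f := by
  obtain ⟨c₂, s, hc₂, hs, hfs⟩ :=
    exists_eq_C_mul_sq hf hg hcop hf0 (n := n) (by rw [hn]; ring) h₀ h₁ h₂ h₃ h₄
  obtain ⟨m, hm⟩ := exists_sq_eq_of_sq_eq (n := n) (b := C c₂) (r := p * g) hs
    (by rw [hn, ← hfs]; ring)
  obtain ⟨i, j, c, z, hc, hz, hpz⟩ :=
    exists_eq_mul_sq hg hcop hc₂ hp0 (m := m) (by rw [hm]; ring) h₅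
  set b := C c * (80 + 9 * X) ^ (i : ℕ) * (320 + 81 * X ^ 2) ^ (j : ℕ) with hb
  obtain ⟨m', hm'⟩ := exists_sq_eq_of_sq_eq (n := m) (b := b) (r := C c₂ * g) hz
    (by rw [hm, ← hpz]; ring)
  have hbt : ∀ t, b.eval t = c * (80 + 9 * t) ^ (i : ℕ) * (320 + 81 * t ^ 2) ^ (j : ℕ) := by
    intro t
    simp [hb]
  have hγ : ∀ t, (rootα - rootβ).eval t = 320 * (-20 + 9 * t) * (-16 + 27 * t) := by
    intro t
    rw [rootα_sub_rootβ]
    simp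
  have hγ' : ∀ t, (rootα - rootβ).derivative.eval t =
      320 * 9 * (-16 + 27 * t) + 320 * (-20 + 9 * t) * 27 := by
    intro t
    rw [rootα_sub_rootβ]
    simp [derivative_mul]
  -- The values at the two zeros of `α - β` determine the constant `c` and the exponents `i`, `j`.
  have s₁ := isSquare_eval_of_root hf hg hcop hc₂ hfs hm' (t := 20 / 9)
    (by rw [hbt]; norm_num [hc]) (by rw [hγ]; norm_num) (by rw [hγ']; norm_num)
  have s₂ := isSquare_eval_of_root hf hg hcop hc₂ hfs hm' (t := 16 / 27)
    (by rw [hbt]; norm_num [hc]) (by rw [hγ]; norm_num) (by rw [hγ']; norm_num)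
  rw [hbt] at s₁ s₂
  have s₁₂ := s₁.mul s₂
  have n₃ : ¬ IsSquare (3 : ℚ) := not_isSquare_of_padicValRat (p := 3)
    (by rw [show (3 : ℚ) = (3 : ℕ) ^ 1 * (1 : ℤ) by norm_num,
      ParityChar.cast_padicValRat 1 (by norm_num)]; decide)
  have n₅ : ¬ IsSquare (5 : ℚ) := not_isSquare_of_padicValRat (p := 5)
    (by rw [show (5 : ℚ) = (5 : ℕ) ^ 1 * (1 : ℤ) by norm_num,
      ParityChar.cast_padicValRat 1 (by norm_num)]; decide)
  have n₁₅ : ¬ IsSquare (15 : ℚ) := not_isSquare_of_padicValRat (p := 5)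
    (by rw [show (15 : ℚ) = (5 : ℕ) ^ 1 * (3 : ℤ) by norm_num,
      ParityChar.cast_padicValRat 1 (by norm_num)]; decide)
  have hij : i = 0 ∧ j = 0 ∧ IsSquare c := by
    have key : ∀ {x y z : ℚ}, IsSquare x → z ≠ 0 → x = y * (z * z) → IsSquare y := by
      rintro x y z ⟨r, hr⟩ hz h
      exact ⟨r / z, by field_simp; linear_combination hr - h⟩
    fin_cases i <;> fin_cases j <;> norm_num at s₁ s₂ s₁₂ ⊢
    · exact s₁
    · exact absurd (key s₁₂ (z := c * 12 * 56 / 3) (by positivity) (by ring)) n₅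
    · exact absurd (key s₁₂ (z := c * 10 * 16 / 3) (by positivity) (by ring)) n₃
    · exact absurd (key s₁₂ (z := c * 10 * 12 * 16 * 56 / 9) (by positivity) (by ring)) n₁₅
  obtain ⟨rfl, rfl, hcs⟩ := hij
  have hpz' : p = C c * z ^ 2 := by rw [hpz, hb]; simp
  have hα' : ∀ t, rootα.derivative.eval t =
      243 * (2 * t) * (16 + 9 * t) * (20 + 3 * t) + 243 * t ^ 2 * 9 * (20 + 3 * t) +
        243 * t ^ 2 * (16 + 9 * t) * 3 := by
    intro t
    rw [rootα]
    simp [derivative_mul]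
    ring
  have s₃ := isSquare_mul_of_root hf hcop hc hpz' hfs (t := -16 / 9)
    (by rw [rootα]; simp; norm_num) (by rw [hα']; norm_num)
  have hc₂s : IsSquare c₂ := by
    have := s₃.mul hcs
    obtain ⟨r, hr⟩ := this
    exact ⟨r / c, by field_simp; linear_combination hr⟩
  exact ⟨by rw [hpz']; exact (hcs.map C).mul ⟨z, sq z⟩,
    by rw [hfs]; exact (hc₂s.map C).mul ⟨s, sq s⟩⟩

end

theorem ratFunc_eq_of_mul_denom (χ : ParityChar ℚ[X]) {w : Qa} {f q : ℚ[X]} (hq : q ≠ 0)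
    (hw : w ≠ 0) (h : w * ι q ^ 2 = ι f) : χ.ratFunc w = χ f := by
  have hq' := ι_ne_zero hq
  rw [← χ.ratFunc_algebraMap, ← h, χ.ratFunc.map_mul hw (pow_ne_zero 2 hq'),
    χ.ratFunc.map_sq hq', add_zero]

/-- The inverse of the matrix `orderMatrix`. -/
def orderMatrixInv : Matrix (Fin 6) (Fin 6) (ZMod 2) :=
  !![0, 0, 1, 1, 0, 1; 0, 0, 0, 1, 1, 0; 1, 0, 0, 1, 1, 0; 0, 1, 1, 1, 1, 0; 0, 1, 0, 1, 0, 0;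
    0, 0, 0, 1, 0, 0]

theorem orderMatrix_mul_inv : orderMatrix * orderMatrixInv = 1 := by decide

theorem inv_mul_orderMatrix : orderMatrixInv * orderMatrix = 1 := by decide

variable [DecidableEq Qa]

/-- The upper bound for `E / 2 E`: a point on which the six characters vanish is divisible by
two. -/
theorem exists_half_of_orderChar {P : E.toAffine.Point} (hP : ∀ k, orderChar k P = 0) :
    ∃ Q, Q + Q = P := by
  rcases P with _ | ⟨x, y, h⟩
  · exact ⟨0, add_zero 0⟩
  have hx : x * (x - ι rootα) * (x - ι rootβ) ≠ 0 := fun h0 => by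
    have hxy := eq_T_of_X h h0
    obtain ⟨k, hk⟩ := exists_orderChar_ne_zero (P := .some x y h)
      ((add_self_eq_zero_iff _).2 (Or.inr hxy)) (Point.some_ne_zero h)
    exact hk (hP k)
  obtain ⟨⟨hx0, hxα⟩, hxβ⟩ : (x ≠ 0 ∧ x - ι rootα ≠ 0) ∧ x - ι rootβ ≠ 0 := by
    simpa only [mul_ne_zero_iff] using hx
  obtain ⟨q, n, hqm, hd, hcop, -, hn⟩ := exists_lowest_terms h
  have hq := hqm.ne_zero
  have hq' := ι_ne_zero hq
  have e₀ := num_mul_sq hd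
  have eα : (x - ι rootα) * ι q ^ 2 = ι (x.num - rootα * q ^ 2) := by
    rw [sub_mul, e₀]
    simp
  have hα : ∀ χ, charα χ (.some x y h) = χ (x.num - rootα * q ^ 2) := fun χ => by
    rw [charα_apply, kummer_some _ (sub_ne_zero.1 hxα), ratFunc_eq_of_mul_denom χ hq hxα eα]
  have h₀ : ∀ χ, char₀ χ (.some x y h) = χ x.num := fun χ => by
    rw [char₀_apply, kummer_some _ hx0, sub_zero, ratFunc_eq_of_mul_denom χ hq hx0 e₀]
  obtain ⟨s₀, sα⟩ := isSquare_of_order rfl rfl hcop (RatFunc.num_ne_zero hx0)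
    (fun h0 => by
      rw [h0, map_zero] at eα
      exact mul_ne_zero hxα (pow_ne_zero 2 hq') eα) hn
    (by rw [← hα]; exact hP 0) (by rw [← hα]; exact hP 1) (by rw [← hα]; exact hP 2)
    (by rw [← hα]; exact hP 3) (by rw [← hα]; exact hP 4) (by rw [← h₀]; exact hP 5)
  have hs₀ : IsSquare x := by
    obtain ⟨r, hr⟩ := s₀.map ι
    exact ⟨r / ι q, by field_simp; rw [e₀, hr]; ring⟩
  have hsα : IsSquare (x - ι rootα) := by
    obtain ⟨r, hr⟩ := sα.map ι
    exact ⟨r / ι q, by field_simp; rw [eα, hr]; ring⟩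
  have hsβ : IsSquare (x - ι rootβ) := by
    obtain ⟨r, hr⟩ := hs₀
    obtain ⟨s, hs⟩ := hsα
    have hr0 : r ≠ 0 := by rintro rfl; simp [hr] at hx0
    have hs0 : s ≠ 0 := by rintro rfl; simp [hs] at hxα
    have := (E₀.equation_iff _ _).1 h.1
    rw [sub_zero, hs, hr] at this
    exact ⟨y / (r * s), by field_simp; rw [hr]; linear_combination -this⟩
  exact E₀.exists_half two_ne ια_ne.symm ιβ_ne.symm ια_ne_ιβ (by simpa using hs₀) hsα hsβ

theorem orderChar_sum (k : Fin 6) (ε : Fin 6 → ℕ) :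
    orderChar k (∑ i, ε i • gen i) = (orderMatrix.mulVec fun i => (ε i : ZMod 2)) k := by
  simp [map_sum, orderChar_gen, Matrix.mulVec, dotProduct, mul_comm]

/-- The points `gen i` generate `E / 2 E`. -/
theorem exists_eq_sum_add_double (P : E.toAffine.Point) :
    ∃ (ε : Fin 6 → ZMod 2) (Q : E.toAffine.Point), P = ∑ i, (ε i).val • gen i + (Q + Q) := by
  set ε := orderMatrixInv.mulVec fun k => orderChar k P with hε
  obtain ⟨Q, hQ⟩ := exists_half_of_orderChar (P := P - ∑ i, (ε i).val • gen i) fun k => by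
    rw [map_sub, orderChar_sum]
    simp only [ZMod.natCast_val, ZMod.cast_id', id]
    rw [hε, Matrix.mulVec_mulVec, orderMatrix_mul_inv, Matrix.one_mulVec, sub_self]
  exact ⟨ε, Q, by rw [hQ]; abel⟩

end

/-! ### Absence of poles at `a = -2` -/

section

open Polynomial WeierstrassCurve.Affine

variable [DecidableEq Qa]

/-- The point `P` reduces to the point at infinity at the place `a = -2`. -/
def HasPole (P : E.toAffine.Point) : Prop :=
  ∃ x y h, P = .some x y h ∧ x.denom.eval (-2) = 0

/-- Where `x` has a pole, its leading coefficient is a square. -/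
theorem leadChar_of_hasPole {P : E.toAffine.Point} (hP : HasPole P) (k : Fin 6) :
    leadChar k P = 0 := by
  obtain ⟨x, y, h, rfl, hx⟩ := hP
  obtain ⟨q, n, hqm, hd, hcop, -, hn⟩ := exists_lowest_terms h
  have hq := hqm.ne_zero
  rw [hd] at hx
  have hq2 : q.eval (-2) = 0 := by simpa using hx
  have hp2 : x.num.eval (-2) ≠ 0 := eval_ne_zero_of_isCoprime hcop.symm hq2
  have hs : IsSquare (x.num.eval (-2)) := by
    have := congrArg (eval (-2)) hn
    simp [hq2] at this
    exact ⟨n.eval (-2) / x.num.eval (-2), by field_simp; linear_combination -this⟩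
  have hrα : ∀ r : ℚ[X], (x.num - r * q ^ 2).eval (-2) = x.num.eval (-2) := by
    intro r
    simp [hq2]
  have e₀ : ∀ r : ℚ[X], (x - ι r) * ι q ^ 2 = ι (x.num - r * q ^ 2) := fun r => by
    rw [sub_mul, num_mul_sq hd]
    simp
  have hne : ∀ r : ℚ[X], x - ι r ≠ 0 := fun r h0 => by
    have := e₀ r
    rw [h0, zero_mul, eq_comm, map_eq_zero_iff _ ι_injective] at this
    rw [← hrα r, this, eval_zero] at hp2
    exact hp2 rfl
  have hα : ∀ p [Fact p.Prime], charα (.lead (-2) p) (.some x y h) = 0 := fun p _ => by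
    rw [charα_apply, kummer_some _ (sub_ne_zero.1 (hne _)),
      ratFunc_eq_of_mul_denom _ hq (hne _) (e₀ _),
      ParityChar.lead_of_eval_ne_zero (by rwa [hrα]), hrα,
      ParityChar.cast_padicValRat_eq_zero hs]
  have h₀ : ∀ p [Fact p.Prime], char₀ (.lead (-2) p) (.some x y h) = 0 := fun p _ => by
    have hx0 : x ≠ 0 := by simpa using hne 0
    rw [char₀_apply, kummer_some _ hx0, sub_zero,
      ratFunc_eq_of_mul_denom _ hq hx0 (num_mul_sq hd),
      ParityChar.lead_of_eval_ne_zero hp2, ParityChar.cast_padicValRat_eq_zero hs]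
  fin_cases k
  exacts [hα 2, h₀ 3, hα 5, h₀ 7, hα 7, hα 19]

omit [DecidableEq Qa] in
/-- The matrix `leadMatrix` is invertible. -/
theorem leadMatrix_mulVec_eq_zero {ε : Fin 6 → ZMod 2} (h : leadMatrix.mulVec ε = 0) : ε = 0 := by
  have hinv : !![1, 0, 1, 1, 0, 1; 0, 1, 0, 0, 1, 1; 0, 1, 0, 1, 1, 0; 1, 0, 0, 1, 0, 1;
    1, 0, 0, 1, 1, 1; 0, 0, 0, 0, 0, 1] * leadMatrix = 1 := by decide
  rw [← Matrix.one_mulVec ε, ← hinv, ← Matrix.mulVec_mulVec, h, Matrix.mulVec_zero]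

/-- The characters `leadChar` separate the classes of `E / 2 E`. -/
theorem exists_half_of_hasPole {P : E.toAffine.Point} (hP : HasPole P) : ∃ Q, Q + Q = P := by
  obtain ⟨ε, Q, hQ⟩ := exists_eq_sum_add_double P
  have hε : ε = 0 := by
    apply leadMatrix_mulVec_eq_zero
    ext k
    have := leadChar_of_hasPole hP k
    rw [hQ, map_add, map_add, CharTwo.add_self_eq_zero, add_zero, map_sum] at this
    simp only [map_nsmul, leadChar_gen, nsmul_eq_mul, ZMod.natCast_val, ZMod.cast_id', id] at this
    simpa [Matrix.mulVec, dotProduct, mul_comm] using this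
  exact ⟨Q, by rw [hQ, hε]; simp⟩

/-- If `x - e` vanishes at `a = -2`, then translation by the point `(e, 0)` of order two produces a
pole. -/
theorem hasPole_add {e f g : ℚ[X]} (hE : IsSplit E (ι e) (ι f) (ι g)) (hef : (e - f).eval (-2) ≠ 0)
    (heg : (e - g).eval (-2) ≠ 0) {h₀ : E.toAffine.Nonsingular (ι e) 0}
    {x y : Qa} {h : E.toAffine.Nonsingular x y} {q : ℚ[X]} (hd : x.denom = q ^ 2)
    (hq : q.eval (-2) ≠ 0) (hx : (x.num - e * q ^ 2).eval (-2) = 0)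
    (hne : Point.some (ι e) 0 h₀ + .some x y h ≠ 0) :
    HasPole (.some (ι e) 0 h₀ + .some x y h) := by
  rcases hP : Point.some (ι e) 0 h₀ + .some x y h with _ | ⟨x', y', h'⟩
  · exact absurd hP hne
  refine ⟨x', y', h', hP, ?_⟩
  obtain ⟨q', n', hqm', hd', hcop', -, -⟩ := exists_lowest_terms h'
  have h1 : Point.some (ι e) 0 h₀ + .some x y h + -.some x' y' h' = 0 := by
    rw [hP, add_neg_cancel]
  rw [Point.neg_some] at h1
  have h2 := hE.mul_of_add_eq h1
  have h3 : (x.num - e * q ^ 2) * (x'.num - e * q' ^ 2) = (e - f) * (e - g) * (q * q') ^ 2 := by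
    apply ι_injective
    simp only [map_mul, map_sub, map_pow]
    rw [← num_mul_sq hd, ← num_mul_sq hd']
    linear_combination (ι q * ι q') ^ 2 * h2
  have h4 := congrArg (eval (-2)) h3
  rw [eval_mul, hx, zero_mul, eval_mul, eval_mul, eval_pow, eval_mul, eq_comm] at h4
  rw [eval_sub] at hef heg
  have h5 : q'.eval (-2) = 0 := by simpa [hef, heg, hq] using h4
  rw [hd', eval_pow, h5, zero_pow two_ne_zero]

/-- A point with a pole which is divisible by two is twice a point with a pole. -/
theorem exists_hasPole_half {P Q : E.toAffine.Point} (hP : HasPole P) (hQ : Q + Q = P) :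
    ∃ Q', HasPole Q' ∧ Q' + Q' = P := by
  obtain ⟨x', y', h', rfl, hx'⟩ := hP
  rcases Q with _ | ⟨x, y, h⟩
  · exact absurd (hQ.symm.trans (add_zero _)) (Point.some_ne_zero _)
  obtain ⟨q, n, hqm, hd, hcop, hy, hn⟩ := exists_lowest_terms h
  obtain ⟨q', n', hqm', hd', hcop', -, -⟩ := exists_lowest_terms h'
  by_cases hq : q.eval (-2) = 0
  · exact ⟨_, ⟨x, y, h, rfl, by rw [hd, eval_pow, hq, zero_pow two_ne_zero]⟩, hQ⟩
  have hq' : q'.eval (-2) = 0 := by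
    rw [hd', eval_pow] at hx'
    exact pow_eq_zero_iff two_ne_zero |>.1 hx'
  have hp' : x'.num.eval (-2) ≠ 0 := eval_ne_zero_of_isCoprime hcop'.symm hq'
  have hιq := ι_ne_zero hqm.ne_zero
  have key : 4 * n ^ 2 * q ^ 2 * x'.num =
      (x.num ^ 2 - rootα * rootβ * q ^ 4) ^ 2 * q' ^ 2 := by
    obtain ⟨-, hdbl⟩ := E₀.double two_ne hQ
    apply ι_injective
    have e2 : y * ι q ^ 3 = ι n := by rw [hy, div_mul_cancel₀ _ (pow_ne_zero 3 hιq)]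
    simp only [map_mul, map_pow, map_sub, map_ofNat]
    rw [← num_mul_sq hd', ← num_mul_sq hd, ← e2]
    linear_combination ι q ^ 8 * ι q' ^ 2 * hdbl
  have hn0 : n.eval (-2) = 0 := by
    have := congrArg (eval (-2)) key
    simpa [hq', hp', hq] using this
  have htrans : ∀ {T : E.toAffine.Point}, T + T = 0 → HasPole (T + .some x y h) →
      ∃ Q', HasPole Q' ∧ Q' + Q' = .some x' y' h' := fun {T} hT hT' =>
    ⟨_, hT', by rw [add_add_add_comm, hT, zero_add, hQ]⟩
  have hne : ∀ {T : E.toAffine.Point}, T + T = 0 → T + .some x y h ≠ 0 := fun {T} hT h0 => by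
    rw [eq_neg_of_add_eq_zero_right h0, ← neg_add, hT, neg_zero] at hQ
    exact Point.some_ne_zero _ hQ.symm
  have h1 : T₁ = .some (ι 0) 0 (E_nonsingular (by simp)) := by simp [T₁, point]
  have h2 : T₂ = .some (ι rootα) 0 (E_nonsingular (by simp)) := by simp [T₂, point]
  have h3 : T₃ = .some (ι rootβ) 0 (E_nonsingular (by simp)) := by simp [T₃, point]
  have t1 : T₁ + T₁ = 0 := (add_self_eq_zero_iff _).2 (by simp)
  have t2 : T₂ + T₂ = 0 := (add_self_eq_zero_iff _).2 (by simp)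
  have t3 : T₃ + T₃ = 0 := (add_self_eq_zero_iff _).2 (by simp)
  have n1 := hne t1
  have n2 := hne t2
  have n3 := hne t3
  have hα : rootα.eval (-2) ≠ 0 := by simp [rootα]; norm_num
  have hβ : rootβ.eval (-2) ≠ 0 := by simp [rootβ]; norm_num
  have hγ : (rootα - rootβ).eval (-2) ≠ 0 := by rw [rootα_sub_rootβ]; simp; norm_num
  have hprod := congrArg (eval (-2)) hn
  rw [eval_pow, hn0, zero_pow two_ne_zero, eval_mul, eval_mul, eq_comm] at hprod
  rcases mul_eq_zero.1 hprod with h0 | h0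
  · rcases mul_eq_zero.1 h0 with h0 | h0
    · refine htrans t1 ?_
      rw [h1] at n1 ⊢
      exact hasPole_add (by simpa using E₀) (by simpa using hα) (by simpa using hβ) hd hq
        (by simpa using h0) n1
    · refine htrans t2 ?_
      rw [h2] at n2 ⊢
      exact hasPole_add (f := 0) (by simpa using Eα) (by simpa using hα) hγ hd hq h0 n2
  · refine htrans t3 ?_
    rw [h3] at n3 ⊢
    exact hasPole_add (f := 0) (g := rootα) (by simpa using Eβ) (by simpa using hβ)
      (by rw [← neg_sub, eval_neg]; exact neg_ne_zero.2 hγ) hd hq h0 n3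

/-- No affine point reduces to the point at infinity at `a = -2`: such a point would be infinitely
divisible by two, with denominators of decreasing degrees. -/
theorem not_hasPole (P : E.toAffine.Point) : ¬ HasPole P := by
  induction hd : denomDegree P using Nat.strong_induction_on generalizing P with
  | _ d ih =>
    intro hP
    obtain ⟨Q₀, hQ₀⟩ := exists_half_of_hasPole hP
    obtain ⟨Q₁, hpole₁, hQ₁⟩ := exists_hasPole_half hP hQ₀
    obtain ⟨Q₂, hQ₂⟩ := exists_half_of_hasPole hpole₁
    have hne : Q₁ ≠ 0 := by
      obtain ⟨x, y, h, rfl, -⟩ := hpole₁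
      exact Point.some_ne_zero h
    have := (denomDegree_lt hQ₂ hne).2
    rw [hQ₁, hd] at this
    exact ih _ this Q₁ rfl hpole₁

end

/-! ### Heights and finite generation -/

section

open Polynomial WeierstrassCurve.Affine Height

/-- The rational function `x` is regular at `a = -2` with value `v`. -/
def Reduces (x : Qa) (v : ℚ) : Prop :=
  x.denom.eval (-2) ≠ 0 ∧ x.eval (RingHom.id ℚ) (-2) = v

namespace Reduces

theorem unique {x : Qa} {v w : ℚ} (hv : Reduces x v) (hw : Reduces x w) : v = w :=
  hv.2.symm.trans hw.2

theorem add {x y : Qa} {v w : ℚ} (hx : Reduces x v) (hy : Reduces y w) :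
    Reduces (x + y) (v + w) := by
  refine ⟨fun h => ?_, ?_⟩
  · have := eval_eq_zero_of_dvd_of_eval_eq_zero (RatFunc.denom_add_dvd x y) h
    rw [eval_mul] at this
    exact (mul_ne_zero hx.1 hy.1) this
  · rw [RatFunc.eval_add, hx.2, hy.2]
    · simpa [eval₂_id] using hx.1
    · simpa [eval₂_id] using hy.1

theorem mul {x y : Qa} {v w : ℚ} (hx : Reduces x v) (hy : Reduces y w) :
    Reduces (x * y) (v * w) := by
  refine ⟨fun h => ?_, ?_⟩
  · have := eval_eq_zero_of_dvd_of_eval_eq_zero (RatFunc.denom_mul_dvd x y) h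
    rw [eval_mul] at this
    exact (mul_ne_zero hx.1 hy.1) this
  · rw [RatFunc.eval_mul, hx.2, hy.2]
    · simpa [eval₂_id] using hx.1
    · simpa [eval₂_id] using hy.1

theorem of_polynomial (f : ℚ[X]) : Reduces (ι f) (f.eval (-2)) := by
  refine ⟨by simp [RatFunc.denom_algebraMap], ?_⟩
  rw [RatFunc.eval_algebraMap]
  simp [eval₂_id]

theorem zero : Reduces 0 0 := by simpa using of_polynomial 0

theorem one : Reduces 1 1 := by simpa using of_polynomial 1

theorem ofNat (n : ℕ) [n.AtLeastTwo] : Reduces (OfNat.ofNat n) (OfNat.ofNat n) := by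
  have := of_polynomial (OfNat.ofNat n)
  simpa only [map_ofNat, eval_ofNat] using this

theorem neg {x : Qa} {v : ℚ} (hx : Reduces x v) : Reduces (-x) (-v) := by
  have := (of_polynomial (-1)).mul hx
  simpa using this

theorem sub {x y : Qa} {v w : ℚ} (hx : Reduces x v) (hy : Reduces y w) :
    Reduces (x - y) (v - w) := by
  rw [sub_eq_add_neg, sub_eq_add_neg]
  exact hx.add hy.neg

theorem sq {x : Qa} {v : ℚ} (hx : Reduces x v) : Reduces (x ^ 2) (v ^ 2) := by
  rw [pow_two, pow_two]
  exact hx.mul hx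

end Reduces

/-- The specialization of `E` at `a = -2`. -/
abbrev specialCurve : WeierstrassCurve ℚ := legendre (rootα.eval (-2)) (rootβ.eval (-2))

theorem reduces_addSubMap {v : Fin 3 → Qa} {w : Fin 3 → ℚ} (h : ∀ i, Reduces (v i) (w i))
    (i : Fin 3) :
    Reduces ((E.addSubMap i).eval v) ((specialCurve.addSubMap i).eval w) := by
  have e₁ := congrFun (legendre_addSubMap_eval (ι rootα) (ι rootβ) v) i
  have e₂ := congrFun (legendre_addSubMap_eval (rootα.eval (-2)) (rootβ.eval (-2)) w) i
  rw [e₁, e₂]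
  have hα := Reduces.of_polynomial rootα
  have hβ := Reduces.of_polynomial rootβ
  have two := Reduces.ofNat 2
  have four := Reduces.ofNat 4
  fin_cases i
  · exact ((h 0).sq.sub (((two.mul (hα.mul hβ)).mul (h 0)).mul (h 2))).add
      ((hα.mul hβ).sq.mul (h 2).sq)
  · exact (((two.mul (h 1)).mul (h 0)).sub (((four.mul (hα.add hβ)).mul (h 0)).mul (h 2))).add
      (((two.mul (hα.mul hβ)).mul (h 1)).mul (h 2))
  · exact (h 1).sq.sub ((four.mul (h 0)).mul (h 2))

/-- The specialization at `a = -2` of the projective `x`-coordinate. -/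
def xSpecial : E.toAffine.Point → Fin 2 → ℚ
  | .zero => ![1, 0]
  | .some x _ _ => ![x.eval (RingHom.id ℚ) (-2), 1]

/-- The specialization at `a = -2` of the unordered pair of the `x`-coordinates of two points. -/
def sym2xSpecial (P Q : E.toAffine.Point) : Fin 3 → ℚ :=
  ![xSpecial P 0 * xSpecial Q 0, xSpecial P 0 * xSpecial Q 1 + xSpecial P 1 * xSpecial Q 0,
    xSpecial P 1 * xSpecial Q 1]

theorem sym2xSpecial_ne_zero (P Q : E.toAffine.Point) : sym2xSpecial P Q ≠ 0 := by
  rcases P with _ | ⟨x, y, h⟩ <;> rcases Q with _ | ⟨x', y', h'⟩ <;>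
    simp [sym2xSpecial, xSpecial]

theorem xSpecial_ne_zero (P : E.toAffine.Point) : ![xSpecial P 0, xSpecial P 1] ≠ 0 := by
  rcases P with _ | ⟨x, y, h⟩ <;> simp [xSpecial]

theorem isElliptic_specialCurve : specialCurve.IsElliptic := by
  rw [WeierstrassCurve.isElliptic_iff, isUnit_iff_ne_zero]
  simp [specialCurve, WeierstrassCurve.Δ, WeierstrassCurve.b₂, WeierstrassCurve.b₄,
    WeierstrassCurve.b₆, WeierstrassCurve.b₈, legendre, rootα, rootβ]
  norm_num

theorem exists_sym2x_eq_one (P Q : E.toAffine.Point) : ∃ i, P.sym2x Q i = 1 := by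
  rcases P with _ | ⟨x, y, h⟩ <;> rcases Q with _ | ⟨x', y', h'⟩
  · exact ⟨0, by simp [Point.sym2x, Point.xRep]⟩
  · exact ⟨1, by simp [Point.sym2x, Point.xRep]⟩
  · exact ⟨1, by simp [Point.sym2x, Point.xRep]⟩
  · exact ⟨2, by simp [Point.sym2x, Point.xRep]⟩

variable [DecidableEq Qa]

theorem reduces_xRep (P : E.toAffine.Point) (i : Fin 2) : Reduces (P.xRep i) (xSpecial P i) := by
  rcases P with _ | ⟨x, y, h⟩
  · fin_cases i
    · exact Reduces.one
    · exact Reduces.zero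
  · fin_cases i
    · exact ⟨fun h0 => not_hasPole (.some x y h) ⟨x, y, h, rfl, h0⟩, rfl⟩
    · exact Reduces.one

theorem reduces_sym2x (P Q : E.toAffine.Point) (i : Fin 3) :
    Reduces (P.sym2x Q i) (sym2xSpecial P Q i) := by
  have hP := reduces_xRep P
  have hQ := reduces_xRep Q
  fin_cases i
  · exact (hP 0).mul (hQ 0)
  · exact ((hP 0).mul (hQ 1)).add ((hP 1).mul (hQ 0))
  · exact (hP 1).mul (hQ 1)

/-- The specialization at `a = -2` of `addSubMap_sym2x`. -/
theorem addSubMap_sym2xSpecial (P Q : E.toAffine.Point) :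
    ∃ c : ℚ, c ≠ 0 ∧ (fun i => (specialCurve.addSubMap i).eval (sym2xSpecial P Q)) =
      c • sym2xSpecial (P + Q) (P - Q) := by
  obtain ⟨c, hc⟩ := addSubMap_sym2x two_ne (ι rootα) (ι rootβ) P Q
  have h := reduces_addSubMap (reduces_sym2x P Q)
  have h' : ∀ i, Reduces (c * (P + Q).sym2x (P - Q) i)
      ((specialCurve.addSubMap i).eval (sym2xSpecial P Q)) := fun i => by
    have := congrFun hc i
    simp only [Pi.smul_apply, smul_eq_mul] at this
    rw [← this]
    exact h i
  -- The factor of proportionality is regular because one coordinate is `1`.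
  obtain ⟨j, hj⟩ := exists_sym2x_eq_one (P + Q) (P - Q)
  have hcj := h' j
  rw [hj, mul_one] at hcj
  have heq : (fun i => (specialCurve.addSubMap i).eval (sym2xSpecial P Q)) =
      (specialCurve.addSubMap j).eval (sym2xSpecial P Q) • sym2xSpecial (P + Q) (P - Q) := by
    ext i
    exact (h' i).unique (hcj.mul (reduces_sym2x _ _ i))
  refine ⟨_, fun h0 => ?_, heq⟩
  have := isElliptic_specialCurve
  rw [h0, zero_smul] at heq
  exact specialCurve.addSubMap_ne_zero (sym2xSpecial_ne_zero P Q) heq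

/-- The height of a point of `E`: the logarithmic height of the specialization of its
`x`-coordinate at `a = -2`. -/
def height (P : E.toAffine.Point) : ℝ := logHeight ![xSpecial P 0, xSpecial P 1]

/-- The approximate parallelogram law for the height. -/
theorem exists_parallelogram_bound : ∃ C : ℝ, ∀ P Q : E.toAffine.Point,
    |height (P + Q) + height (P - Q) - 2 * (height P + height Q)| ≤ C := by
  have := isElliptic_specialCurve
  obtain ⟨C₁, h₁⟩ := specialCurve.abs_logHeight_addSubMap_sub_two_mul_logHeight_le
  obtain ⟨C₂, h₂⟩ := abs_logHeight_sym2_sub_le ℚ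
  refine ⟨C₁ + 3 * C₂, fun P Q => ?_⟩
  obtain ⟨c, hc, h⟩ := addSubMap_sym2xSpecial P Q
  have e₁ := h₁ (sym2xSpecial P Q)
  rw [h, logHeight_smul_eq_logHeight _ hc] at e₁
  have e₂ := h₂ (xSpecial_ne_zero P) (xSpecial_ne_zero Q)
  have e₃ := h₂ (xSpecial_ne_zero (P + Q)) (xSpecial_ne_zero (P - Q))
  simp only [height]
  simp only [sym2xSpecial] at e₁
  rw [abs_le] at *
  constructor <;> linarith

/-- Points with the same specialized `x`-coordinate are equal up to sign. -/
theorem eq_or_eq_neg_of_special_eq {x y x' y' : Qa} {h : E.toAffine.Nonsingular x y}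
    {h' : E.toAffine.Nonsingular x' y'}
    (hx : x.eval (RingHom.id ℚ) (-2) = x'.eval (RingHom.id ℚ) (-2)) :
    Point.some x y h = .some x' y' h' ∨ Point.some x y h = -.some x' y' h' := by
  obtain ⟨c, hc, h0⟩ := addSubMap_sym2xSpecial (.some x y h) (.some x' y' h')
  rw [legendre_addSubMap_eval] at h0
  have h2 := congrFun h0 2
  have h3 : xSpecial (.some x y h + .some x' y' h') 1 * xSpecial (.some x y h - .some x' y' h') 1
      = 0 := by
    have h4 : c * (xSpecial (.some x y h + .some x' y' h') 1 *
        xSpecial (.some x y h - .some x' y' h') 1) = 0 := by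
      refine Eq.trans h2.symm ?_
      simp [sym2xSpecial, xSpecial, hx]
      ring
    exact (mul_eq_zero.1 h4).resolve_left hc
  have key : ∀ P : E.toAffine.Point, xSpecial P 1 = 0 → P = 0 := by
    rintro (_ | ⟨x, y, h⟩) hP
    · rfl
    · simp [xSpecial] at hP
  rcases mul_eq_zero.1 h3 with h3 | h3
  · exact Or.inr (eq_neg_of_add_eq_zero_left (key _ h3))
  · exact Or.inl (sub_eq_zero.1 (key _ h3))

/-- There are at most two points above each rational number of bounded height. -/
instance northcott_height : Northcott height where
  finite_le B := by
    have hfin : {v : ℚ | logHeight₁ v ≤ B}.Finite := Northcott.finite_le B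
    have hsub : {P : E.toAffine.Point | height P ≤ B} ⊆
        {0} ∪ ⋃ v ∈ {v : ℚ | logHeight₁ v ≤ B},
          {P | ∃ x y h, P = .some x y h ∧ x.eval (RingHom.id ℚ) (-2) = v} := by
      rintro (_ | ⟨x, y, h⟩) hP
      · exact Or.inl rfl
      · refine Or.inr (Set.mem_biUnion (x := x.eval (RingHom.id ℚ) (-2)) ?_ ⟨x, y, h, rfl, rfl⟩)
        change logHeight₁ _ ≤ B
        rw [logHeight₁_eq_logHeight]
        exact hP
    refine ((Set.finite_singleton _).union (hfin.biUnion fun v _ => ?_)).subset hsub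
    rcases Set.eq_empty_or_nonempty
      {P : E.toAffine.Point | ∃ x y h, P = .some x y h ∧ x.eval (RingHom.id ℚ) (-2) = v} with h | h
    · rw [h]
      exact Set.finite_empty
    · obtain ⟨_, x, y, h, rfl, hx⟩ := h
      refine (Set.toFinite {.some x y h, -.some x y h}).subset ?_
      rintro _ ⟨x', y', h', rfl, hx'⟩
      exact eq_or_eq_neg_of_special_eq (hx'.trans hx.symm)

theorem finiteIndex_double :
    (nsmulAddMonoidHom (α := E.toAffine.Point) 2).range.FiniteIndex := by
  set H := (nsmulAddMonoidHom (α := E.toAffine.Point) 2).range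
  have hsurj : Function.Surjective fun ε : Fin 6 → ZMod 2 =>
      (QuotientAddGroup.mk (∑ i, (ε i).val • gen i) : E.toAffine.Point ⧸ H) := by
    intro z
    obtain ⟨P, rfl⟩ := QuotientAddGroup.mk_surjective z
    obtain ⟨ε, Q, h⟩ := exists_eq_sum_add_double P
    refine ⟨ε, ?_⟩
    rw [QuotientAddGroup.eq, h]
    exact ⟨Q, by simp [two_nsmul]⟩
  have := Finite.of_surjective _ hsurj
  exact AddSubgroup.finiteIndex_of_finite_quotient

/-- The Mordell–Weil theorem for `E`. -/
theorem fg_points : AddGroup.FG E.toAffine.Point := by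
  obtain ⟨C, hC⟩ := exists_parallelogram_bound
  exact AddCommGroup.fg_of_descent' (h := height) finiteIndex_double
    (fun P => logHeight_nonneg _) hC

end

/-! ### The rank -/

section

open Polynomial WeierstrassCurve.Affine

/-- The matrix `orderMatrix` is invertible. -/
theorem orderMatrix_mulVec_eq_zero {v : Fin 6 → ZMod 2} (h : orderMatrix.mulVec v = 0) : v = 0 := by
  rw [← Matrix.one_mulVec v, ← inv_mul_orderMatrix, ← Matrix.mulVec_mulVec, h, Matrix.mulVec_zero]

/-- A basis, modulo torsion, of a subgroup of finite index. -/
def basisPoint : Fin 4 → E.toAffine.Point := ![P₁, P₂, R, P₄]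

theorem C_inv_mul : (C (1 / 21) : ℚ[X]) * 21 = 1 := by
  rw [← C_ofNat, ← C_mul]
  norm_num

/-- The point with `x = x₃`. -/
def P₃ : E.toAffine.Point :=
  point (C (1 / 21) ^ 2 * ((-4 + 9 * X) * (80 + 9 * X) * (160 + 171 * X) ^ 2))
    (C (1 / 21) ^ 3 * ((80 + 9 * X) * (-4 + 9 * X) * (320 + 81 * X ^ 2) *
      (123120 * X ^ 2 - 404640 * X - 486400))) (by
    have h := C_inv_mul
    set c : ℚ[X] := C (1 / 21)
    set u : ℚ[X] := (-4 + 9 * X) * (80 + 9 * X) * (160 + 171 * X) ^ 2 with hu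
    have hsub : ∀ r, c ^ 2 * u - r = c ^ 2 * (u - 441 * r) := fun r => by
      linear_combination r * (c * 21 + 1) * h
    rw [hsub, hsub, hu, rootα, rootβ]
    ring)

variable [DecidableEq Qa]

/-- Addition of points with polynomial coordinates on a line of polynomial slope. -/
theorem point_add {x₁ y₁ x₂ y₂ x₃ y₃ : ℚ[X]} {h₁ : y₁ ^ 2 = x₁ * (x₁ - rootα) * (x₁ - rootβ)}
    {h₂ : y₂ ^ 2 = x₂ * (x₂ - rootα) * (x₂ - rootβ)}
    {h₃ : y₃ ^ 2 = x₃ * (x₃ - rootα) * (x₃ - rootβ)} (ℓ : ℚ[X]) (hx : x₁ ≠ x₂)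
    (hℓ : y₁ - y₂ = ℓ * (x₁ - x₂)) (hx₃ : x₃ = ℓ ^ 2 + rootα + rootβ - x₁ - x₂)
    (hy₃ : y₃ = -(y₁ + ℓ * (x₃ - x₁))) : point x₁ y₁ h₁ + point x₂ y₂ h₂ = point x₃ y₃ h₃ := by
  have hx' : ι x₁ ≠ ι x₂ := ι_injective.ne hx
  have hs : E.toAffine.slope (ι x₁) (ι x₂) (ι y₁) (ι y₂) = ι ℓ := by
    rw [slope_of_X_ne hx', div_eq_iff (sub_ne_zero.2 hx'), ← map_sub, ← map_sub, hℓ, map_mul]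
  have hX : E.toAffine.addX (ι x₁) (ι x₂) (ι ℓ) = ι x₃ := by
    rw [addX, E₀.a₁, E₀.a₂, hx₃]
    simp only [map_sub, map_add, map_pow]
    ring
  rw [point, point, Point.add_of_X_ne hx', point, Point.some.injEq, hs]
  refine ⟨hX, ?_⟩
  rw [addY, negAddY, hX, E₀.negY, hy₃]
  simp only [map_neg, map_sub, map_add, map_mul]
  ring

theorem P₁_add_R : P₁ + R =
    point (9 * X * (-4 + 9 * X) * (320 + 81 * X ^ 2))
      (-(X * (-4 + 9 * X) * (320 + 81 * X ^ 2) * (2880 + 6480 * X)))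
      (by rw [rootα, rootβ]; ring) := by
  refine point_add (320 - 81 * X ^ 2) ?_ ?_ ?_ ?_
  · exact sub_ne_zero.1 (ne_zero_of_eval 1 (by simp; norm_num))
  · ring
  · rw [rootα, rootβ]; ring
  · ring

theorem P₃_eq : P₃ = P₁ + 2 • R := by
  have h := C_inv_mul
  rw [two_nsmul, ← add_assoc, P₁_add_R]
  symm
  refine point_add (C (1 / 21) * (1539 * X ^ 2 + 6080)) ?_ ?_ ?_ ?_
  · exact sub_ne_zero.1 (ne_zero_of_eval 1 (by simp; norm_num))
  · linear_combination 36 * (1539 * X ^ 2 + 6080) * X * (320 + 81 * X ^ 2) * h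
  · rw [rootα, rootβ]
    linear_combination (243 * X ^ 2 * (16 + 9 * X) * (20 + 3 * X) +
      (80 + 9 * X) * (-4 + 9 * X) * (320 + 81 * X ^ 2) - 9 * X * (-4 + 9 * X) * (320 + 81 * X ^ 2) -
      9 * X * (80 + 9 * X) * (320 + 81 * X ^ 2)) * (C (1 / 21) * 21 + 1) * h
  · linear_combination (X * (-4 + 9 * X) * (320 + 81 * X ^ 2) * (2880 + 6480 * X) *
      (441 * C (1 / 21) ^ 2 + 21 * C (1 / 21) + 1) + C (1 / 21) * (1539 * X ^ 2 + 6080) *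
      (9 * X * (-4 + 9 * X) * (320 + 81 * X ^ 2)) * (C (1 / 21) * 21 + 1)) * h

theorem orderChar_zsmul_sum (k : Fin 6) (n : Fin 6 → ℤ) :
    orderChar k (∑ i, n i • gen i) = (orderMatrix.mulVec fun i => (n i : ZMod 2)) k := by
  simp [map_sum, orderChar_gen, Matrix.mulVec, dotProduct, mul_comm]

/-- Infinite descent: the coefficients of a relation between the basis points modulo torsion are
divisible by all powers of two. -/
theorem two_pow_dvd_of_torsion (k : ℕ) : ∀ n : Fin 4 → ℤ,
    IsOfFinAddOrder (∑ i, n i • basisPoint i) → ∀ i, (2 : ℤ) ^ k ∣ n i := by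
  induction k with
  | zero => intro n _ i; simp
  | succ k ih =>
    intro n hn
    have hex : ∃ m : Fin 2 → ℤ, ∑ i, n i • basisPoint i = m 0 • T₁ + m 1 • T₂ := by
      rcases (mem_torsion_iff _).1 hn with h | h | h | h
      · exact ⟨![0, 0], by simp [h]⟩
      · exact ⟨![1, 0], by simp [h]⟩
      · exact ⟨![0, 1], by simp [h]⟩
      · exact ⟨![1, 1], by simp [h, T₁_add_T₂]⟩
    obtain ⟨m, hm⟩ := hex
    have hrel : ∑ i, (![n 0, n 1, n 2, n 3, -m 0, -m 1] : Fin 6 → ℤ) i • gen i = 0 := by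
      simp only [Fin.sum_univ_four, basisPoint, Matrix.cons_val] at hm
      simp only [Fin.sum_univ_six, gen, Matrix.cons_val]
      rw [hm]
      module
    have hv := orderMatrix_mulVec_eq_zero
      (v := fun i => ((![n 0, n 1, n 2, n 3, -m 0, -m 1] : Fin 6 → ℤ) i : ZMod 2)) (by
        ext k
        rw [← orderChar_zsmul_sum, hrel, map_zero]
        rfl)
    have heven : ∀ i, (2 : ℤ) ∣ n i := by
      intro i
      have h2 : ∀ j : Fin 6, (2 : ℤ) ∣ (![n 0, n 1, n 2, n 3, -m 0, -m 1] : Fin 6 → ℤ) j :=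
        fun j => (ZMod.intCast_zmod_eq_zero_iff_dvd _ 2).1 (congrFun hv j)
      fin_cases i
      exacts [h2 0, h2 1, h2 2, h2 3]
    choose n' hn' using heven
    have hdouble : ∑ i, n i • basisPoint i = 2 • ∑ i, n' i • basisPoint i := by
      rw [Finset.smul_sum]
      refine Finset.sum_congr rfl fun i _ => ?_
      rw [hn', mul_smul]
      norm_cast
    rw [hdouble] at hn
    intro i
    rw [hn', pow_succ']
    exact mul_dvd_mul_left 2 (ih n' ((isOfFinAddOrder_nsmul.1 hn).resolve_right two_ne_zero) i)

theorem eq_zero_of_torsion {n : Fin 4 → ℤ} (hn : IsOfFinAddOrder (∑ i, n i • basisPoint i)) :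
    n = 0 := by
  ext i
  by_contra h0
  have h := two_pow_dvd_of_torsion (n i).natAbs n hn i
  have h1 := Int.natAbs_dvd_natAbs.2 h
  rw [Int.natAbs_pow] at h1
  exact absurd (Nat.le_of_dvd (Int.natAbs_pos.2 h0) h1)
    (not_le.2 (Nat.lt_two_pow_self))

theorem linearIndependent_basisPoint : LinearIndependent ℤ basisPoint := by
  rw [Fintype.linearIndependent_iff]
  intro n hn i
  exact congrFun (eq_zero_of_torsion (by rw [hn]; exact IsOfFinAddOrder.zero)) i

theorem linearIndependent_P : LinearIndependent ℤ ![P₁, P₂, P₃, P₄] := by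
  have h := Fintype.linearIndependent_iff.1 linearIndependent_basisPoint
  rw [Fintype.linearIndependent_iff]
  intro n hn
  have h' := h ![n 0 + n 2, n 1, 2 * n 2, n 3] (by
    rw [← hn]
    simp only [Fin.sum_univ_four, basisPoint, Matrix.cons_val, P₃_eq]
    module)
  have h0 := h' 0
  have h1 := h' 1
  have h2 := h' 2
  have h3 := h' 3
  simp only [Matrix.cons_val] at h0 h1 h2 h3
  intro i
  fin_cases i <;> simp <;> omega

/-- Since the points `gen i` generate `E / 2 E` and `E` is finitely generated, they generate a
subgroup of finite odd index. -/
theorem exists_smul_mem_span : ∃ r : ℤ, r ≠ 0 ∧ ∀ P : E.toAffine.Point,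
    r • P ∈ Submodule.span ℤ (Set.range gen) := by
  set S := Submodule.span ℤ (Set.range gen)
  have := fg_points
  have : Module.Finite ℤ E.toAffine.Point := Module.Finite.iff_addGroup_fg.2 fg_points
  obtain ⟨r, hr, h⟩ := Submodule.exists_sub_one_mem_and_smul_eq_zero_of_fg_of_le_smul
    (Ideal.span {(2 : ℤ)}) (⊤ : Submodule ℤ (E.toAffine.Point ⧸ S)) Module.Finite.fg_top (by
      rintro z -
      obtain ⟨P, rfl⟩ := S.mkQ_surjective z
      obtain ⟨ε, Q, hP⟩ := exists_eq_sum_add_double P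
      have h1 : S.mkQ P = (2 : ℤ) • S.mkQ Q := by
        rw [hP, map_add, map_add, two_smul, add_eq_right, Submodule.mkQ_apply,
          Submodule.Quotient.mk_eq_zero]
        exact Submodule.sum_mem _ fun i _ => S.smul_of_tower_mem _
          (Submodule.subset_span ⟨i, rfl⟩)
      rw [h1]
      exact Submodule.smul_mem_smul (Ideal.mem_span_singleton_self 2) trivial)
  refine ⟨r, ?_, fun P => ?_⟩
  · rintro rfl
    rw [Ideal.mem_span_singleton] at hr
    omega
  · rw [← Submodule.Quotient.mk_eq_zero]
    exact h (S.mkQ P) trivial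

theorem rank_points : Module.rank ℤ E.toAffine.Point = 4 := by
  set L := Submodule.span ℤ (Set.range basisPoint) with hL
  have hrank : Module.rank ℤ L = 4 := by
    rw [hL, rank_span linearIndependent_basisPoint]
    rw [Cardinal.mk_range_eq _ linearIndependent_basisPoint.injective]
    simp
  have hquot : Module.rank ℤ (E.toAffine.Point ⧸ L) = 0 := by
    rw [Module.rank_eq_zero_iff_isTorsion]
    intro z
    obtain ⟨P, rfl⟩ := L.mkQ_surjective z
    obtain ⟨r, hr, h⟩ := exists_smul_mem_span
    refine ⟨⟨2 * r, mem_nonZeroDivisors_of_ne_zero (mul_ne_zero two_ne_zero hr)⟩, ?_⟩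
    change (2 * r) • L.mkQ P = 0
    rw [← map_smul, Submodule.mkQ_apply, Submodule.Quotient.mk_eq_zero, mul_smul]
    have hle : Submodule.span ℤ (Set.range gen) ≤ L.comap (LinearMap.lsmul ℤ _ 2) := by
      rw [Submodule.span_le]
      rintro _ ⟨i, rfl⟩
      change (2 : ℤ) • gen i ∈ L
      have hb : ∀ j, (2 : ℤ) • basisPoint j ∈ L := fun j =>
        L.smul_mem _ (Submodule.subset_span ⟨j, rfl⟩)
      have ht : ∀ T : E.toAffine.Point, T + T = 0 → (2 : ℤ) • T ∈ L := fun T hT => by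
        rw [two_zsmul, hT]
        exact L.zero_mem
      fin_cases i
      exacts [hb 0, hb 1, hb 2, hb 3, ht T₁ ((add_self_eq_zero_iff _).2 (by simp)),
        ht T₂ ((add_self_eq_zero_iff _).2 (by simp))]
    exact hle (h P)
  rw [← rank_quotient_add_rank_of_isDomain L, hquot, hrank, zero_add]

end

/-! ### Return to the induced curve -/

section

open Polynomial WeierstrassCurve.Affine

/-- An isomorphism of groups restricts to the torsion subgroups. -/
def torsionEquiv {G H : Type*} [AddCommGroup G] [AddCommGroup H] (φ : G ≃+ H) :
    AddCommGroup.torsion G ≃+ AddCommGroup.torsion H :=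
  (φ.addSubgroupMap _).trans (AddEquiv.addSubgroupCongr (by
    ext P
    constructor
    · rintro ⟨Q, hQ, rfl⟩
      exact φ.toAddMonoidHom.isOfFinAddOrder hQ
    · exact fun hP => ⟨φ.symm P, φ.symm.toAddMonoidHom.isOfFinAddOrder hP, φ.apply_symm_apply P⟩))

section rescale

variable {F : Type*} [Field F] {W W' : WeierstrassCurve F} {e f g u r : F}

theorem IsSplit.Δ_eq (hW : IsSplit W e f g) :
    W.Δ = 16 * ((e - f) * (e - g) * (f - g)) ^ 2 := by
  simp only [WeierstrassCurve.Δ, WeierstrassCurve.b₂, WeierstrassCurve.b₄, WeierstrassCurve.b₆,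
    WeierstrassCurve.b₈, hW.a₁, hW.a₂, hW.a₃, hW.a₄, hW.a₆]
  ring

theorem IsSplit.isElliptic (hW : IsSplit W e f g) (h2 : (2 : F) ≠ 0) (hef : e ≠ f) (heg : e ≠ g)
    (hfg : f ≠ g) : W.IsElliptic := by
  rw [WeierstrassCurve.isElliptic_iff, isUnit_iff_ne_zero, hW.Δ_eq,
    show (16 : F) = 2 ^ 4 by norm_num]
  exact mul_ne_zero (pow_ne_zero 4 h2) (pow_ne_zero 2 (mul_ne_zero (mul_ne_zero (sub_ne_zero.2 hef)
    (sub_ne_zero.2 heg)) (sub_ne_zero.2 hfg)))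

theorem IsSplit.equation_rescale (hW : IsSplit W (u ^ 2 * e + r) (u ^ 2 * f + r) (u ^ 2 * g + r))
    (hW' : IsSplit W' e f g) (hu : u ≠ 0) (x y : F) :
    W.toAffine.Equation (u ^ 2 * x + r) (u ^ 3 * y) ↔ W'.toAffine.Equation x y := by
  rw [hW.equation_iff, hW'.equation_iff, ← mul_right_inj' (pow_ne_zero 6 hu) (b := y ^ 2)]
  constructor <;> intro h <;> linear_combination h

theorem slope_rescale [DecidableEq F]
    (hW : IsSplit W (u ^ 2 * e + r) (u ^ 2 * f + r) (u ^ 2 * g + r)) (hW' : IsSplit W' e f g)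
    (hu : u ≠ 0) (x₁ x₂ y₁ y₂ : F) (hxy : ¬(x₁ = x₂ ∧ y₁ = W'.toAffine.negY x₂ y₂)) :
    W.toAffine.slope (u ^ 2 * x₁ + r) (u ^ 2 * x₂ + r) (u ^ 3 * y₁) (u ^ 3 * y₂) =
      u * W'.toAffine.slope x₁ x₂ y₁ y₂ := by
  by_cases hx : x₁ = x₂
  · subst hx
    have hy : y₁ ≠ -y₂ := fun h => hxy ⟨rfl, by rw [hW'.negY, h]⟩
    have hy' : y₁ ≠ W'.toAffine.negY x₁ y₂ := by rwa [hW'.negY]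
    have hy'' : u ^ 3 * y₁ ≠ W.toAffine.negY (u ^ 2 * x₁ + r) (u ^ 3 * y₂) := by
      rw [hW.negY, ← mul_neg]
      exact fun h => hy (mul_left_cancel₀ (pow_ne_zero 3 hu) h)
    rw [slope_of_Y_ne rfl hy', slope_of_Y_ne rfl hy'', hW.negY, hW'.negY, hW.a₁, hW'.a₁, hW.a₂,
      hW'.a₂, hW.a₄, hW'.a₄, sub_neg_eq_add, sub_neg_eq_add, ← mul_add (u ^ 3), ← mul_div_assoc]
    by_cases h0 : y₁ + y₁ = 0
    · rw [h0, mul_zero, div_zero, div_zero]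
    · rw [div_eq_div_iff (mul_ne_zero (pow_ne_zero 3 hu) h0) h0]
      ring
  · have hx' : u ^ 2 * x₁ + r ≠ u ^ 2 * x₂ + r := fun h =>
      hx (mul_left_cancel₀ (pow_ne_zero 2 hu) (add_right_cancel h))
    rw [slope_of_X_ne hx, slope_of_X_ne hx', ← mul_div_assoc,
      div_eq_div_iff (sub_ne_zero.2 hx') (sub_ne_zero.2 hx)]
    ring

/-- The change of variables `x = u ^ 2 X + r`, `y = u ^ 3 Y` is an isomorphism of groups of
points. -/
theorem IsSplit.exists_addEquiv [DecidableEq F]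
    (hW : IsSplit W (u ^ 2 * e + r) (u ^ 2 * f + r) (u ^ 2 * g + r)) (hW' : IsSplit W' e f g)
    (hu : u ≠ 0) (h2 : (2 : F) ≠ 0) (hef : e ≠ f) (heg : e ≠ g) (hfg : f ≠ g) :
    ∃ φ : W'.toAffine.Point ≃+ W.toAffine.Point, ∀ x y h, ∃ h',
      φ (.some x y h) = .some (u ^ 2 * x + r) (u ^ 3 * y) h' := by
  have hne : ∀ {x y : F}, x ≠ y → u ^ 2 * x + r ≠ u ^ 2 * y + r := fun hxy h =>
    hxy (mul_left_cancel₀ (pow_ne_zero 2 hu) (add_right_cancel h))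
  have hns : ∀ {x y : F}, W'.toAffine.Nonsingular x y →
      W.toAffine.Nonsingular (u ^ 2 * x + r) (u ^ 3 * y) := fun h =>
    hW.nonsingular h2 (hne hef) (hne heg) (hne hfg)
      ((hW.equation_iff _ _).1 ((hW.equation_rescale hW' hu _ _).2 h.1))
  let φ₀ : W'.toAffine.Point → W.toAffine.Point := fun P =>
    match P with
    | .zero => 0
    | .some _ _ h => .some _ _ (hns h)
  have hadd : ∀ P Q, φ₀ (P + Q) = φ₀ P + φ₀ Q := by
    rintro (_ | ⟨x₁, y₁, h₁⟩) Q
    · exact (congrArg φ₀ (zero_add Q)).trans (zero_add _).symm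
    rcases Q with _ | ⟨x₂, y₂, h₂⟩
    · exact (congrArg φ₀ (add_zero (Point.some x₁ y₁ h₁))).trans (add_zero _).symm
    by_cases hxy : x₁ = x₂ ∧ y₁ = W'.toAffine.negY x₂ y₂
    · rw [Point.add_of_Y_eq hxy.1 hxy.2]
      refine (Point.add_of_Y_eq (by rw [hxy.1]) ?_).symm
      rw [hxy.2, hW.negY, hW'.negY, mul_neg]
    · have hxy' : ¬(u ^ 2 * x₁ + r = u ^ 2 * x₂ + r ∧
          u ^ 3 * y₁ = W.toAffine.negY (u ^ 2 * x₂ + r) (u ^ 3 * y₂)) := by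
        rintro ⟨hx, hy⟩
        rw [hW.negY, ← mul_neg] at hy
        refine hxy ⟨mul_left_cancel₀ (pow_ne_zero 2 hu) (add_right_cancel hx), ?_⟩
        rw [hW'.negY]
        exact mul_left_cancel₀ (pow_ne_zero 3 hu) hy
      have hs := slope_rescale hW hW' hu x₁ x₂ y₁ y₂ hxy
      rw [Point.add_some hxy]
      refine Eq.trans ?_ (Point.add_some hxy').symm
      have hX : u ^ 2 * W'.toAffine.addX x₁ x₂ (W'.toAffine.slope x₁ x₂ y₁ y₂) + r =
          W.toAffine.addX (u ^ 2 * x₁ + r) (u ^ 2 * x₂ + r)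
            (u * W'.toAffine.slope x₁ x₂ y₁ y₂) := by
        rw [addX, addX, hW.a₁, hW.a₂, hW'.a₁, hW'.a₂]
        ring
      simp only [φ₀, Point.some.injEq, hs]
      refine ⟨hX, ?_⟩
      rw [addY, addY, negAddY, negAddY, ← hX, hW.negY, hW'.negY]
      ring
  have hinj : Function.Injective φ₀ := by
    rintro (_ | ⟨x₁, y₁, h₁⟩) (_ | ⟨x₂, y₂, h₂⟩) h
    · rfl
    · exact absurd h.symm (Point.some_ne_zero _)
    · exact absurd h (Point.some_ne_zero _)
    · simp only [φ₀, Point.some.injEq] at h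
      simp only [Point.some.injEq]
      exact ⟨mul_left_cancel₀ (pow_ne_zero 2 hu) (add_right_cancel h.1),
        mul_left_cancel₀ (pow_ne_zero 3 hu) h.2⟩
  have hsurj : Function.Surjective φ₀ := by
    rintro (_ | ⟨x, y, h⟩)
    · exact ⟨0, rfl⟩
    · have hx : u ^ 2 * ((x - r) / u ^ 2) + r = x := by field_simp; ring
      have hy : u ^ 3 * (y / u ^ 3) = y := by field_simp
      refine ⟨.some ((x - r) / u ^ 2) (y / u ^ 3) (hW'.nonsingular h2 hef heg hfg ?_), ?_⟩
      · rw [← hW'.equation_iff, ← hW.equation_rescale hW' hu, hx, hy]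
        exact h.1
      · simp only [φ₀, Point.some.injEq]
        exact ⟨hx, hy⟩
  exact ⟨AddEquiv.ofBijective (AddMonoidHom.mk' φ₀ hadd) ⟨hinj, hsurj⟩, fun x y h => ⟨hns h, rfl⟩⟩

end rescale

theorem a_ne_zero : (a : Qa) ≠ 0 := RatFunc.X_ne_zero

/-- The numerators of the `q i` over the common denominator `756 a`. -/
def qNum : Fin 4 → ℚ[X] :=
  ![-(324 * X ^ 2), -((80 + 9 * X) * (-4 + 9 * X)), 1280, -((4 + 9 * X) * (-80 + 9 * X))]

theorem mul_q (i : Fin 4) : 756 * a * q i = ι (qNum i) := by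
  have ha := a_ne_zero
  fin_cases i <;> simp only [q, qNum, Matrix.cons_val, Fin.reduceFinMk, Fin.zero_eta, Fin.mk_one,
    Fin.isValue, map_neg, map_mul, map_add, map_pow, map_ofNat, ι_X] <;> field_simp <;> ring

theorem eval_qNum (i : Fin 4) :
    (qNum i).eval (-2) = (![-1296, 1364, 1280, -1372] : Fin 4 → ℚ) i := by
  fin_cases i <;> simp [qNum] <;> norm_num

theorem isDiophantineTuple_q : IsDiophantineTuple q := by
  have ha := a_ne_zero
  refine ⟨fun i hi => ?_, fun i j hij => ?_, ?_⟩
  · have h := mul_q i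
    rw [hi, mul_zero, eq_comm, map_eq_zero_iff _ ι_injective] at h
    have := eval_qNum i
    rw [h, eval_zero] at this
    fin_cases i <;> norm_num at this
  · have h : qNum i = qNum j := ι_injective (by rw [← mul_q, ← mul_q, hij])
    have h' := congrArg (eval (-2)) h
    rw [eval_qNum, eval_qNum] at h'
    fin_cases i <;> fin_cases j <;> first | rfl | norm_num at h'
  · have key : ∀ i j, i < j → IsSquare (q i * q j + 1) := by
      intro i j hij
      fin_cases i <;> fin_cases j <;> first | exact absurd hij (by decide) | skip
      · exact ⟨(9 * a + 38) / 42, by simp [q]; field_simp; ring⟩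
      · exact ⟨11 / 21, by simp [q]; field_simp; ring⟩
      · exact ⟨(9 * a - 38) / 42, by simp [q]; field_simp; ring⟩
      · exact ⟨(342 * a - 320) / (378 * a), by simp [q]; field_simp; ring⟩
      · exact ⟨(81 * a ^ 2 + 320) / (756 * a), by simp [q]; field_simp; ring⟩
      · exact ⟨(342 * a + 320) / (378 * a), by simp [q]; field_simp; ring⟩
    intro i j hij
    rcases lt_or_gt_of_ne hij with h | h
    · exact key i j h
    · rw [mul_comm]
      exact key j i h

theorem isSplit_curve :
    IsSplit curve ((toModel.u : Qa) ^ 2 * 0 + toModel.r)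
      ((toModel.u : Qa) ^ 2 * ι rootα + toModel.r)
      ((toModel.u : Qa) ^ 2 * ι rootβ + toModel.r) := by
  have ha := a_ne_zero
  have h₀ : (toModel.u : Qa) ^ 2 * 0 + toModel.r = -(q 0 * q 1) := by simp [toModel]
  have hα : (toModel.u : Qa) ^ 2 * ι rootα + toModel.r = -(q 0 * q 2) := by
    simp only [toModel, rootα, q, Matrix.cons_val, Units.val_inv_eq_inv_val, Units.val_mk0,
      map_mul, map_add, map_pow, map_ofNat, ι_X]
    field_simp
    ring
  have hβ : (toModel.u : Qa) ^ 2 * ι rootβ + toModel.r = -(q 1 * q 2) := by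
    simp only [toModel, rootβ, q, Matrix.cons_val, Units.val_inv_eq_inv_val, Units.val_mk0, map_neg,
      map_mul, map_add, map_pow, map_ofNat, ι_X]
    field_simp
    ring
  rw [h₀, hα, hβ]
  constructor <;> simp only [curve, inducedCurve] <;> ring

theorem isElliptic_curve : curve.IsElliptic := by
  have hne : ∀ {x y : Qa}, x ≠ y →
      (toModel.u : Qa) ^ 2 * x + toModel.r ≠ (toModel.u : Qa) ^ 2 * y + toModel.r := fun hxy h =>
    hxy (mul_left_cancel₀ (pow_ne_zero 2 toModel.u.ne_zero) (add_right_cancel h))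
  exact isSplit_curve.isElliptic two_ne (hne ια_ne.symm) (hne ιβ_ne.symm) (hne ια_ne_ιβ)

variable [DecidableEq Qa]

theorem exists_addEquiv_curve :
    ∃ φ : E.toAffine.Point ≃+ curve.toAffine.Point, ∀ x y h, ∃ h',
      φ (.some x y h) =
        .some ((toModel.u : Qa) ^ 2 * x + toModel.r) ((toModel.u : Qa) ^ 3 * y) h' :=
  isSplit_curve.exists_addEquiv E₀ toModel.u.ne_zero two_ne ια_ne.symm ιβ_ne.symm ια_ne_ιβ

omit [DecidableEq Qa] in
theorem exists_eq_some (i : Fin 4) :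
    ∃ y h, ![P₁, P₂, P₃, P₄] i = (.some (xcoord i) y h : E.toAffine.Point) := by
  have key : ∀ {P : E.toAffine.Point} {x' : Qa}, P ≠ 0 → P.xRep 0 = x' →
      ∃ y' h', P = .some x' y' h' := by
    rintro (_ | ⟨x, y, h⟩) _ hP rfl
    · exact absurd rfl hP
    · exact ⟨y, h, rfl⟩
  have hC : ι (C (1 / 21)) = 1 / 21 := by
    have := congrArg ι C_inv_mul
    rw [map_mul, map_ofNat, map_one] at this
    exact (eq_div_of_mul_eq (by norm_num) this)
  fin_cases i <;> (refine key (by exact Point.some_ne_zero _) ?_; simp only [P₁, P₂, P₃, P₄, point,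
    Point.xRep_some, xcoord, Matrix.cons_val, Fin.reduceFinMk, Fin.zero_eta, Fin.mk_one,
    Fin.isValue, map_neg, map_mul, map_add, map_pow, map_ofNat, ι_X, hC]) <;> ring

end

end DiophantineTriple

end

open DiophantineTriple in
theorem theorem2 [DecidableEq Qa] :
    IsDiophantineTuple q ∧
    curve.IsElliptic ∧
    Nonempty (AddCommGroup.torsion curve.toAffine.Point ≃+ ZMod 2 × ZMod 2) ∧
    Module.rank ℤ curve.toAffine.Point = 4 ∧
    (∀ i, ∃ P : curve.toAffine.Point, HasModelX P (xcoord i)) ∧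
    ∀ P : Fin 4 → curve.toAffine.Point, (∀ i, HasModelX (P i) (xcoord i)) →
      (∀ i, addOrderOf (P i) = 0) ∧ LinearIndependent ℤ P := by
  obtain ⟨φ, hφ⟩ := exists_addEquiv_curve
  have hpts : ∀ i, HasModelX (φ (![P₁, P₂, P₃, P₄] i)) (xcoord i) := fun i => by
    obtain ⟨y, h, hi⟩ := exists_eq_some i
    obtain ⟨h', hφi⟩ := hφ _ y h
    exact ⟨_, h', by rw [hi, hφi]⟩
  refine ⟨isDiophantineTuple_q, isElliptic_curve, ?_, ?_, fun i => ⟨_, hpts i⟩, fun P hP => ?_⟩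
  · have := isAddKleinFour_torsion
    obtain ⟨ψ⟩ := IsAddKleinFour.nonempty_addEquiv
      (G₁ := AddCommGroup.torsion E.toAffine.Point) (G₂ := ZMod 2 × ZMod 2)
    exact ⟨(torsionEquiv φ).symm.trans ψ⟩
  · rw [← rank_points]
    exact (LinearEquiv.rank_eq φ.toIntLinearEquiv).symm
  · have hsign : ∀ i, ∃ ε : ℤˣ, P i = ε • φ (![P₁, P₂, P₃, P₄] i) := fun i => by
      obtain ⟨y, h, hi⟩ := hP i
      obtain ⟨y', h', hi'⟩ := hpts i
      rw [hi, hi']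
      rcases (WeierstrassCurve.Affine.Point.X_eq_iff (h₁ := h) (h₂ := h')).1 rfl with e | e
      · exact ⟨1, by rw [one_smul, e]⟩
      · exact ⟨-1, by rw [e, Units.neg_smul, one_smul]⟩
    choose ε hε using hsign
    have hli : LinearIndependent ℤ P := by
      have h1 := linearIndependent_P.map' (φ.toIntLinearEquiv : _ →ₗ[ℤ] curve.toAffine.Point)
        (LinearEquiv.ker _)
      rw [show P = ε • (φ.toIntLinearEquiv ∘ ![P₁, P₂, P₃, P₄]) from funext hε]
      exact h1.units_smul ε
    refine ⟨fun i => ?_, hli⟩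
    rw [addOrderOf_eq_zero_iff]
    intro hfin
    obtain ⟨n, hn, h0⟩ := isOfFinAddOrder_iff_nsmul_eq_zero.1 hfin
    have := Fintype.linearIndependent_iff.1 hli (Pi.single i (n : ℤ)) (by
      simp [Pi.single_apply, ite_smul, h0]) i
    simp at this
    omega
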